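/- Let $\mathfrak g$ be a finite-dimensional simple complex Lie algebra of rank $l$ with Cartan matrix $(A_{ij})$, simple roots $\alpha_i$, and invariant form normalized so that long roots have square length $2$; thus $(\alpha_i|\alpha_j)=d_iA_{ij}$ with $d_i=(\alpha_i|\alpha_i)/2$. Let $q=e^{\hbar}\in\mathbb C^\times$ not be a root of unity, put $q^a=e^{a\hbar}$ for $a\in\mathbb Q$, $q_i=q^{d_i}$, and $[a]=\frac{q^a-q^{-a}}{q-q^{-1}}$. The quantum affine algebra $U_q(\widehat{\mathfrak g})$ (Drinfeld realization) is the associative $\mathbb C$-algebra generated by central invertible $\gamma^{1/2}$, and $d$, $k_i^{\pm1}$, $a_i(n)$ ($0\ne n\in\mathbb Z$), $x_i^\pm(n)$ ($n\in\mathbb Z$), $1\le i\le l$, such that the $k_i$ commute with each other, with $d$ and with all $a_j(n)$, $k_ix_j^\pm(n)k_i^{-1}=q^{\pm(\alpha_i|\alpha_j)}x_j^\pm(n)$, $[d,a_i(n)]=na_i(n)$, $[d,x_i^\pm(n)]=nx_i^\pm(n)$, $$[a_i(m),a_j(n)]=\delta_{m,-n}\frac{[(\alpha_i|\alpha_j)m]}{m}\frac{\gamma^m-\gamma^{-m}}{q-q^{-1}},\qquad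 [a_i(m),x_j^\pm(n)]=\pm\frac{[(\alpha_i|\alpha_j)m]}{m}\gamma^{\mp|m|/2}x_j^\pm(m+n),$$ $$x_i^\pm(m+1)x_j^\pm(n)-q^{\pm(\alpha_i|\alpha_j)}x_i^\pm(m)x_j^\pm(n+1)=q^{\pm(\alpha_i|\alpha_j)}x_j^\pm(n)x_i^\pm(m+1)-x_j^\pm(n+1)x_i^\pm(m),$$ $$[x_i^+(m),x_j^-(n)]=\frac{\delta_{ij}}{q_i-q_i^{-1}}\left(\gamma^{(m-n)/2}\psi_i(m+n)-\gamma^{(n-m)/2}\varphi_i(m+n)\right),$$ where $\sum_{n\ge0}\psi_i(n)z^{-n}=k_i\exp\big((q-q^{-1})\sum_{n>0}a_i(n)z^{-n}\big)$, $\sum_{n\ge0}\varphi_i(-n)z^{n}=k_i^{-1}\exp\big((q^{-1}-q)\sum_{n>0}a_i(-n)z^{n}\big)$, $\psi_i(-n)=\varphi_i(n)=0$ for $n>0$; and, for $i\neq j$, $N=1-A_{ij}$, all $n_1,\dots,n_N,m\in\mathbb Z$, with $q_i$-binomial coefficients, $$\sum_{\sigma\in S_N}\sum_{s=0}^N(-1)^s\begin{bmatrix}N\\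 s\end{bmatrix}_i x_i^\pm(n_{\sigma(1)})\cdots x_i^\pm(n_{\sigma(s)})\,x_j^\pm(m)\,x_i^\pm(n_{\sigma(s+1)})\cdots x_i^\pm(n_{\sigma(N)})=0 .$$ Let $k\in\mathbb Q$, $k\ne0$, and let $V$ be a $U_q(\widehat{\mathfrak g})$-module of level $k$ ($\gamma^{1/2}$ acts as $q^{k/2}$) such that $V=\bigoplus_{a\in\mathbb C}V_a$ with $V_a=\{v: dv=av\}$, all weight spaces (joint eigenspaces of $d$ and the $k_i$) are finite-dimensional, and for each $a\in\mathbb C$ one has $V_{a+n}=0$ for all sufficiently large integers $n$. On any space on which the $a_i(n)$ act, put $$E_-^{\pm}(\pm'\alpha_i,z)=\exp\Big(\mp\sum_{n\ge1}\tfrac{q^{\mp kn/2}}{[kn]}(\pm'a_i(-n))z^n\Big),\qquad E_+^{\pm}(\pm'\alpha_i,z)=\exp\Big(\pm\sum_{n\ge1}\tfrac{q^{\mp kn/2}}{[kn]}(\pm'a_i(n))z^{-n}\Big),$$ where the sign $\pm'$ is independent of $\pm$. Let $x_i^\pm(z)=\sum_{n}x_i^\pm(n)z^{-n-1}$ and,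 on $V$, $Z^\pm(\alpha_i,z)=E_-^\pm(\alpha_i,z)\,x_i^\pm(z)\,E_+^\pm(\alpha_i,z)$. Let $$\Omega_V=\{v\in V: E_+^\pm(\alpha_i,z)v=E_+^\pm(-\alpha_i,z)v=v\ \text{for all } i\text{ and both signs}\}.$$ Let $K(k)$ be the polynomial algebra in the variables $a_i(-n)$ ($1\le i\le l$, $n\ge1$), on which $a_i(-n)$ acts by multiplication and $a_i(n)$ acts as the derivation with $a_j(-m)\mapsto\delta_{m,n}\frac1n[(\alpha_i|\alpha_j)n][nk]$, and let $i:K(k)\to U_q(\widehat{\mathfrak g})$ be the algebra homomorphism with $a_j(-n)\mapsto a_j(-n)$. Then every coefficient of $Z^\pm(\alpha_i,z)$ is well defined on $V$ (applied to a vector, it is a finite sum), and the linear map $$K(k)\otimes_{\mathbb C}\Omega_V\longrightarrow V,\qquad u\otimes w\longmapsto i(u)\cdot w$$ is an isomorphism. Moreover the coefficients of $Z^\pm(\alpha_i,z)$ preserve $\Omega_V$, and under this isomorphism $$x_i^\pm(z)=E_-^\pm(-\alpha_i,z)E_+^\pm(-\alpha_i,z)\otimes Z^\pm(\alpha_i,z)$$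 for all $i$, where the exponentials act on $K(k)$ and $Z^\pm(\alpha_i,z)$ acts on $\Omega_V$ (coefficient by coefficient in $z$, each coefficient applied to a vector being a finite sum). -/

import Mathlib

open scoped TensorProduct

noncomputable section

namespace QAff

/-! ### Simple types, Cartan matrices and the normalized form -/

/-- The types of finite-dimensional simple complex Lie algebras `𝔤`; equivalently the types
`X_l^{(1)}` of the affine Lie algebras of type one. -/
inductive SimpleType : Type
  | A (l : ℕ) (hl : 1 ≤ l)
  | B (l : ℕ) (hl : 2 ≤ l)
  | C (l : ℕ) (hl : 2 ≤ l)
  | D (l : ℕ) (hl : 4 ≤ l)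
  | E6
  | E7
  | E8
  | F4
  | G2

namespace SimpleType

/-- The rank `l` of `𝔤`. -/
abbrev rank : SimpleType → ℕ
  | A l _ => l
  | B l _ => l
  | C l _ => l
  | D l _ => l
  | E6 => 6
  | E7 => 7
  | E8 => 8
  | F4 => 4
  | G2 => 2

/-- The index set of the simple roots. -/
abbrev Idx (X : SimpleType) : Type := Fin X.rank

/-- The Cartan matrix `A i j = ⟨α_i^∨, α_j⟩ = 2 (α_i|α_j) / (α_i|α_i)`. Mathlib's matrices use
the transposed (Bourbaki) convention. -/
def cartan : (X : SimpleType) → Matrix X.Idx X.Idx ℤ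
  | A l _ => (CartanMatrix.A l).transpose
  | B l _ => (CartanMatrix.B l).transpose
  | C l _ => (CartanMatrix.C l).transpose
  | D l _ => (CartanMatrix.D l).transpose
  | E6 => CartanMatrix.E₆.transpose
  | E7 => CartanMatrix.E₇.transpose
  | E8 => CartanMatrix.E₈.transpose
  | F4 => CartanMatrix.F₄.transpose
  | G2 => CartanMatrix.G₂.transpose

/-- `d_i = (α_i|α_i)/2` for the standard normalized invariant form (long roots have square
length `2`). -/
def dd : (X : SimpleType) → X.Idx → ℚ
  | A _ _ => fun _ => 1
  | B l _ => fun i : Fin l => if i.val + 1 = l then 1 / 2 else 1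
  | C l _ => fun i : Fin l => if i.val + 1 = l then 1 else 1 / 2
  | D _ _ => fun _ => 1
  | E6 => fun _ => 1
  | E7 => fun _ => 1
  | E8 => fun _ => 1
  | F4 => fun i : Fin 4 => if i.val < 2 then 1 else 1 / 2
  | G2 => fun i : Fin 2 => if i.val = 0 then 1 else 1 / 3

/-- The values `(α_i|α_j) = d_i A_{ij}` of the normalized invariant form. -/
def form (X : SimpleType) (i j : X.Idx) : ℚ := X.dd i * (X.cartan i j : ℚ)

end SimpleType

/-! ### q-numbers -/

/-- `q^a` for rational `a`, where `q = exp ħ`. -/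
def qpow (ħ : ℂ) (a : ℚ) : ℂ := Complex.exp ((a : ℂ) * ħ)

/-- `[a] = (q^a - q^{-a}) / (q - q^{-1})`. -/
def qnum (ħ : ℂ) (a : ℚ) : ℂ :=
  (qpow ħ a - qpow ħ (-a)) / (qpow ħ 1 - qpow ħ (-1))

/-- `[n]_i = (q_i^n - q_i^{-n}) / (q_i - q_i^{-1})` where `q_i = q^d`, `d = d_i`. -/
def qint (ħ : ℂ) (d : ℚ) (n : ℕ) : ℂ :=
  (qpow ħ (d * n) - qpow ħ (-(d * n))) / (qpow ħ d - qpow ħ (-d))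

/-- `[n]_i! = [1]_i ⋯ [n]_i`. -/
def qfact (ħ : ℂ) (d : ℚ) (n : ℕ) : ℂ := ∏ t ∈ Finset.range n, qint ħ d (t + 1)

/-- The `q_i`-binomial coefficient; only used for `n ≤ m`. -/
def qbinom (ħ : ℂ) (d : ℚ) (m n : ℕ) : ℂ :=
  qfact ħ d m / (qfact ħ d n * qfact ħ d (m - n))

/-! ### Exponentials of formal power series -/

/-- `exp f = ∑_j f^j / j!` for a power series `f` with zero constant term over a (not necessarily
commutative) `ℂ`-algebra: the powers `f^j` with `j > n` do not contribute to degree `n`. -/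
def psExp {R : Type*} [Ring R] [Algebra ℂ R] (f : PowerSeries R) : PowerSeries R :=
  PowerSeries.mk fun n =>
    ∑ j ∈ Finset.range (n + 1), ((j.factorial : ℂ)⁻¹) • PowerSeries.coeff n (f ^ j)

/-- `∑_{n ≥ 1} c(n) b(n) t^n`. -/
def modeSeries {R : Type*} [Ring R] [Algebra ℂ R] (c : ℕ+ → ℂ) (b : ℕ+ → R) : PowerSeries R :=
  PowerSeries.mk fun n => if h : 0 < n then c ⟨n, h⟩ • b ⟨n, h⟩ else 0

/-! ### The quantum affine algebra in Drinfeld's realization -/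

/-- Nonzero integers, the mode numbers of the Heisenberg generators. -/
abbrev NZ : Type := {n : ℤ // n ≠ 0}

/-- The mode number `n`. -/
def NZ.pos (n : ℕ+) : NZ := ⟨((n : ℕ) : ℤ), by exact_mod_cast n.ne_zero⟩

/-- The mode number `-n`. -/
def NZ.neg (n : ℕ+) : NZ := ⟨-((n : ℕ) : ℤ), by simp⟩

/-- Generators: `γ^{1/2}`, `γ^{-1/2}`, `d`, `k_i`, `k_i^{-1}`, `a_i(n)` for `n ≠ 0`, and
`x_i^ε(n)` for `ε = ±1`. -/
inductive Gen (X : SimpleType) : Type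
  | gamma
  | gammaInv
  | deg
  | k (i : X.Idx)
  | kInv (i : X.Idx)
  | a (i : X.Idx) (n : NZ)
  | x (ε : ℤˣ) (i : X.Idx) (n : ℤ)

section Free

variable (X : SimpleType) (ħ : ℂ)

/-- The free algebra on the generators. -/
abbrev Free : Type := FreeAlgebra ℂ (Gen X)

variable {X}

/-- A generator as an element of the free algebra. -/
abbrev gen (g : Gen X) : Free X := FreeAlgebra.ι ℂ g

variable (X)

/-- `γ^{r/2}` for an integer `r`. -/
def gammaHalfPow (r : ℤ) : Free X :=
  if 0 ≤ r then gen Gen.gamma ^ r.toNat else gen Gen.gammaInv ^ (-r).toNat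

variable {X}

/-- `ψ_i(n)`, defined by `∑_{n ≥ 0} ψ_i(n) z^{-n} = k_i exp((q - q⁻¹) ∑_{n > 0} a_i(n) z^{-n})`
and `ψ_i(n) = 0` for `n < 0`. -/
def psi (i : X.Idx) (n : ℤ) : Free X :=
  if 0 ≤ n then
    gen (Gen.k i) * PowerSeries.coeff n.toNat
      (psExp (modeSeries (fun _ => qpow ħ 1 - qpow ħ (-1)) fun m => gen (Gen.a i (NZ.pos m))))
  else 0

/-- `φ_i(n)`, defined by
`∑_{n ≥ 0} φ_i(-n) z^n = k_i⁻¹ exp((q⁻¹ - q) ∑_{n > 0} a_i(-n) z^n)`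
and `φ_i(n) = 0` for `n > 0`. -/
def phi (i : X.Idx) (n : ℤ) : Free X :=
  if n ≤ 0 then
    gen (Gen.kInv i) * PowerSeries.coeff (-n).toNat
      (psExp (modeSeries (fun _ => qpow ħ (-1) - qpow ħ 1) fun m => gen (Gen.a i (NZ.neg m))))
  else 0

/-- The coefficient of `z_1^{-n_1-1} ⋯ z_N^{-n_N-1} w^{-m-1}` in the left-hand side of the
Serre relation, `N = 1 - A i j`:
`Sym ∑_s (-1)^s [N choose s]_i x_i(z_1) ⋯ x_i(z_s) x_j(w) x_i(z_{s+1}) ⋯ x_i(z_N)`. -/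
def serre (ε : ℤˣ) (i j : X.Idx) (N : ℕ) (n : Fin N → ℤ) (m : ℤ) : Free X :=
  ∑ σ : Equiv.Perm (Fin N), ∑ s ∈ Finset.range (N + 1),
    ((-1) ^ s * qbinom ħ (X.dd i) N s) •
      (((List.ofFn fun t => gen (Gen.x ε i (n (σ t)))).take s).prod * gen (Gen.x ε j m) *
        ((List.ofFn fun t => gen (Gen.x ε i (n (σ t)))).drop s).prod)

variable (X)

/-- The defining relations of `U_q(𝔤^)`, in components. -/
inductive Rel : Free X → Free X → Prop
  | gamma_inv : Rel (gen Gen.gamma * gen Gen.gammaInv) 1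
  | inv_gamma : Rel (gen Gen.gammaInv * gen Gen.gamma) 1
  | gamma_central (g : Gen X) : Rel (gen Gen.gamma * gen g) (gen g * gen Gen.gamma)
  | k_inv (i : X.Idx) : Rel (gen (Gen.k i) * gen (Gen.kInv i)) 1
  | inv_k (i : X.Idx) : Rel (gen (Gen.kInv i) * gen (Gen.k i)) 1
  | k_k (i j : X.Idx) : Rel (gen (Gen.k i) * gen (Gen.k j)) (gen (Gen.k j) * gen (Gen.k i))
  | k_deg (i : X.Idx) : Rel (gen (Gen.k i) * gen Gen.deg) (gen Gen.deg * gen (Gen.k i))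
  | k_a (i j : X.Idx) (n : NZ) :
      Rel (gen (Gen.k i) * gen (Gen.a j n)) (gen (Gen.a j n) * gen (Gen.k i))
  | k_x (ε : ℤˣ) (i j : X.Idx) (n : ℤ) :
      Rel (gen (Gen.k i) * gen (Gen.x ε j n))
        (qpow ħ (((ε : ℤ) : ℚ) * X.form i j) • (gen (Gen.x ε j n) * gen (Gen.k i)))
  | deg_a (i : X.Idx) (n : NZ) :
      Rel (gen Gen.deg * gen (Gen.a i n) - gen (Gen.a i n) * gen Gen.deg)
        ((n.1 : ℂ) • gen (Gen.a i n))
  | deg_x (ε : ℤˣ) (i : X.Idx) (n : ℤ) :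
      Rel (gen Gen.deg * gen (Gen.x ε i n) - gen (Gen.x ε i n) * gen Gen.deg)
        ((n : ℂ) • gen (Gen.x ε i n))
  | a_a (i j : X.Idx) (m n : NZ) :
      Rel (gen (Gen.a i m) * gen (Gen.a j n) - gen (Gen.a j n) * gen (Gen.a i m))
        (if m.1 = -n.1 then
          (qnum ħ (X.form i j * m.1) / (m.1 : ℂ) / (qpow ħ 1 - qpow ħ (-1))) •
            (gammaHalfPow X (2 * m.1) - gammaHalfPow X (-(2 * m.1)))
        else 0)
  | a_x (ε : ℤˣ) (i j : X.Idx) (m : NZ) (n : ℤ) :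
      Rel (gen (Gen.a i m) * gen (Gen.x ε j n) - gen (Gen.x ε j n) * gen (Gen.a i m))
        ((((ε : ℤ) : ℂ) * (qnum ħ (X.form i j * m.1) / (m.1 : ℂ))) •
          (gammaHalfPow X (-((ε : ℤ) * |m.1|)) * gen (Gen.x ε j (m.1 + n))))
  | x_x (ε : ℤˣ) (i j : X.Idx) (m n : ℤ) :
      Rel (gen (Gen.x ε i (m + 1)) * gen (Gen.x ε j n)
          - qpow ħ (((ε : ℤ) : ℚ) * X.form i j) •
            (gen (Gen.x ε i m) * gen (Gen.x ε j (n + 1))))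
        (qpow ħ (((ε : ℤ) : ℚ) * X.form i j) •
            (gen (Gen.x ε j n) * gen (Gen.x ε i (m + 1)))
          - gen (Gen.x ε j (n + 1)) * gen (Gen.x ε i m))
  | xp_xm (i j : X.Idx) (m n : ℤ) :
      Rel (gen (Gen.x 1 i m) * gen (Gen.x (-1) j n) - gen (Gen.x (-1) j n) * gen (Gen.x 1 i m))
        (if i = j then
          (qpow ħ (X.dd i) - qpow ħ (-X.dd i))⁻¹ •
            (gammaHalfPow X (m - n) * psi ħ i (m + n) - gammaHalfPow X (n - m) * phi ħ i (m + n))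
        else 0)
  | serre (ε : ℤˣ) (i j : X.Idx) (hij : i ≠ j) (n : Fin (1 - X.cartan i j).toNat → ℤ) (m : ℤ) :
      Rel (serre ħ ε i j (1 - X.cartan i j).toNat n m) 0

/-- The quantum affine algebra `U_q(𝔤^)` with `q = exp ħ`. -/
def Uq : Type := RingQuot (Rel X ħ)

instance : Ring (Uq X ħ) := inferInstanceAs (Ring (RingQuot (Rel X ħ)))

instance : Algebra ℂ (Uq X ħ) := inferInstanceAs (Algebra ℂ (RingQuot (Rel X ħ)))

/-- The quotient map from the free algebra. -/
def Uq.mk : Free X →ₐ[ℂ] Uq X ħ := RingQuot.mkAlgHom ℂ (Rel X ħ)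

variable {X}

/-- A generator as an element of `U_q(𝔤^)`. -/
def Uq.gen (g : Gen X) : Uq X ħ := Uq.mk X ħ (QAff.gen g)

/-- The creation generators `a_i(-n)`, `n ≥ 1`. -/
def Uq.creation (p : X.Idx × ℕ+) : Uq X ħ := Uq.gen ħ (Gen.a p.1 (NZ.neg p.2))

theorem Uq.creation_comm (p p' : X.Idx × ℕ+) :
    Uq.creation ħ p * Uq.creation ħ p' = Uq.creation ħ p' * Uq.creation ħ p := by
  have h := RingQuot.mkAlgHom_rel ℂ (Rel.a_a (ħ := ħ) p.1 p'.1 (NZ.neg p.2) (NZ.neg p'.2))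
  have hne : ¬ ((NZ.neg p.2).1 = -(NZ.neg p'.2).1) := by
    have h1 := p.2.pos
    have h2 := p'.2.pos
    simp only [NZ.neg]
    omega
  rw [if_neg hne, map_zero, map_sub, map_mul, map_mul, sub_eq_zero] at h
  exact h

end Free

/-! ### The Fock module and the embedding of the creation half -/

section Fock

variable (X : SimpleType) (ħ : ℂ)

/-- The space of `K(k)`: the symmetric algebra on the `a_i(-n)`, `n ≥ 1`, i.e. the polynomial
algebra whose variable `(i, n)` is `a_i(-n)`. -/
abbrev Fock : Type := MvPolynomial (X.Idx × ℕ+) ℂ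

variable {X}

/-- `a_i(-n)` acts on `K(k)` by multiplication. -/
def fockCreate (i : X.Idx) (n : ℕ+) : Module.End ℂ (Fock X) :=
  LinearMap.mulLeft ℂ (MvPolynomial.X (i, n))

/-- `a_i(n)` acts on `K(k)` as the derivation with
`a_j(-m) ↦ [a_i(n), a_j(-m)] = δ_{n,m} (1/n) [(α_i|α_j) n] [n k]`. -/
def fockAnnih (k : ℚ) (i : X.Idx) (n : ℕ+) : Module.End ℂ (Fock X) :=
  (MvPolynomial.mkDerivation ℂ fun p : X.Idx × ℕ+ =>
    if p.2 = n then
      MvPolynomial.C (qnum ħ (X.form i p.1 * (n : ℕ)) * qnum ħ ((n : ℕ) * k) / ((n : ℕ) : ℂ))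
    else (0 : Fock X) : Derivation ℂ (Fock X) (Fock X)).toLinearMap

open scoped IsMulCommutative in
/-- The algebra homomorphism `i` from `U_q(𝔥^⁻) = K(k)` to `U_q(𝔤^)` with `a_i(-n) ↦ a_i(-n)`.
It is evaluation of polynomials in the commutative subalgebra generated by the `a_i(-n)`. -/
def incl : Fock X →ₐ[ℂ] Uq X ħ :=
  have := Algebra.isMulCommutative_adjoin ℂ (s := Set.range (Uq.creation (X := X) ħ))
    (by rintro _ ⟨p, rfl⟩ _ ⟨p', rfl⟩; exact Uq.creation_comm ħ p p')
  (Algebra.adjoin ℂ (Set.range (Uq.creation (X := X) ħ))).val.comp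
    (MvPolynomial.aeval fun p =>
      (⟨Uq.creation ħ p, Algebra.subset_adjoin ⟨p, rfl⟩⟩ :
        Algebra.adjoin ℂ (Set.range (Uq.creation (X := X) ħ))))

theorem incl_X (p : X.Idx × ℕ+) : incl ħ (MvPolynomial.X p) = Uq.creation ħ p := by
  simp [incl]

end Fock

/-! ### Exponential operators `E_∓^±(± α_i, z)` -/

section Exponentials

variable (ħ : ℂ) (k : ℚ) {W : Type*} [AddCommGroup W] [Module ℂ W]

/-- `E_-^ε(σ α_i, z) = exp(-ε ∑_{n ≥ 1} (q^{-ε k n / 2} / [k n]) σ a_i(-n) z^n)` on a space with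
creation modes `b n = a_i(-n)`, as a power series in `z`. -/
def Eminus (ε σ : ℤˣ) (b : ℕ+ → Module.End ℂ W) : PowerSeries (Module.End ℂ W) :=
  psExp (modeSeries (fun n =>
    -((ε : ℤ) : ℂ) * (qpow ħ (-(((ε : ℤ) : ℚ) * k * (n : ℕ) / 2)) / qnum ħ (k * (n : ℕ))) *
      ((σ : ℤ) : ℂ)) b)

/-- `E_+^ε(σ α_i, z) = exp(ε ∑_{n ≥ 1} (q^{-ε k n / 2} / [k n]) σ a_i(n) z^{-n})` on a space with
annihilation modes `b n = a_i(n)`, as a power series in `z⁻¹`. -/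
def Eplus (ε σ : ℤˣ) (b : ℕ+ → Module.End ℂ W) : PowerSeries (Module.End ℂ W) :=
  psExp (modeSeries (fun n =>
    ((ε : ℤ) : ℂ) * (qpow ħ (-(((ε : ℤ) : ℚ) * k * (n : ℕ) / 2)) / qnum ħ (k * (n : ℕ))) *
      ((σ : ℤ) : ℂ)) b)

end Exponentials

/-! ### Modules, vacuum space and Z-operators -/

section Modules

variable {X : SimpleType} (ħ : ℂ) (k : ℚ)
variable (V : Type*) [AddCommGroup V] [Module ℂ V] [Module (Uq X ħ) V] [IsScalarTower ℂ (Uq X ħ) V]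

/-- The action of a generator on a `U_q(𝔤^)`-module. -/
def act (g : Gen X) : Module.End ℂ V := Algebra.lsmul ℂ ℂ V (Uq.gen ħ g)

/-- The modes `a_i(-n)` on `V`. -/
def actCreate (i : X.Idx) (n : ℕ+) : Module.End ℂ V := act ħ V (Gen.a i (NZ.neg n))

/-- The modes `a_i(n)` on `V`. -/
def actAnnih (i : X.Idx) (n : ℕ+) : Module.End ℂ V := act ħ V (Gen.a i (NZ.pos n))

/-- The coefficient of `z^m` in `x_i^ε(z) = ∑_n x_i^ε(n) z^{-n-1}`. -/
def xCoeff (ε : ℤˣ) (i : X.Idx) (m : ℤ) : Module.End ℂ V := act ħ V (Gen.x ε i (-m - 1))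

variable (X)

/-- `V_a = {v | d v = a v}`. -/
def degreeSpace (a : ℂ) : Submodule ℂ V := Module.End.eigenspace (act ħ V (Gen.deg (X := X))) a

/-- The weight space of vectors with `d v = a v` and `k_i v = μ_i v` for all `i`. -/
def weightSpace (a : ℂ) (μ : X.Idx → ℂ) : Submodule ℂ V :=
  degreeSpace X ħ V a ⊓ ⨅ i, Module.End.eigenspace (act ħ V (Gen.k i)) (μ i)

/-- The category of level `k` modules: `γ^{1/2}` acts as `q^{k/2}`, `V` is the sum of its
homogeneous subspaces, weight spaces are finite-dimensional and degrees are bounded above in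
every coset of `ℤ`. -/
structure InCategory : Prop where
  level : ∀ v : V, act ħ V (Gen.gamma (X := X)) v = qpow ħ (k / 2) • v
  graded : ⨆ a, degreeSpace X ħ V a = ⊤
  finite : ∀ (a : ℂ) (μ : X.Idx → ℂ), FiniteDimensional ℂ (weightSpace X ħ V a μ)
  bounded : ∀ a : ℂ, ∃ n₀ : ℕ, ∀ n : ℕ, n₀ < n → degreeSpace X ħ V (a + n) = ⊥

/-- The vacuum space: vectors `v` with `E_+^±(α_i, z) v = E_+^±(-α_i, z) v = v` for all `i`,
compared coefficient by coefficient. -/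
def vacuum : Submodule ℂ V where
  carrier := {v | ∀ (ε σ : ℤˣ) (i : X.Idx) (n : ℕ),
    PowerSeries.coeff n (Eplus ħ k ε σ (actAnnih ħ V i)) v = if n = 0 then v else 0}
  add_mem' := by
    intro v w hv hw ε σ i n
    rw [map_add, hv ε σ i n, hw ε σ i n]
    split_ifs <;> simp
  zero_mem' := by
    intro ε σ i n
    simp
  smul_mem' := by
    intro c v hv ε σ i n
    rw [map_smul, hv ε σ i n]
    split_ifs <;> simp

variable {X}

/-- The summand of the coefficient of `z^m` in
`Z^ε(α_i, z) v = E_-^ε(α_i, z) x_i^ε(z) E_+^ε(α_i, z) v` that takes the coefficient of `z^p` in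
`E_-` and that of `z^{-r}` in `E_+`, where `(p, r)` is the last argument. -/
def zTerm (ε : ℤˣ) (i : X.Idx) (m : ℤ) (v : V) (pr : ℕ × ℕ) : V :=
  PowerSeries.coeff pr.1 (Eminus ħ k ε 1 (actCreate ħ V i))
    (xCoeff ħ V ε i (m - pr.1 + pr.2)
      (PowerSeries.coeff pr.2 (Eplus ħ k ε 1 (actAnnih ħ V i)) v))

/-- The coefficient of `z^m` in `Z^ε(α_i, z) v`. -/
def zCoeff (ε : ℤˣ) (i : X.Idx) (m : ℤ) (v : V) : V := ∑ᶠ pr, zTerm ħ k V ε i m v pr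

end Modules

/-- The coefficient of `z^p` in `E_-^ε(-α_i, z)` composed with that of `z^{-r}` in
`E_+^ε(-α_i, z)`, acting on `K(k)`. -/
def fockEE {X : SimpleType} (ħ : ℂ) (k : ℚ) (ε : ℤˣ) (i : X.Idx) (p r : ℕ) :
    Module.End ℂ (Fock X) :=
  PowerSeries.coeff p (Eminus ħ k ε (-1) (fockCreate i)) *
    PowerSeries.coeff r (Eplus ħ k ε (-1) (fockAnnih ħ k i))

end QAff

end

/-!
At level `k ≠ 0` the operators `a_i(n)` form a Heisenberg algebra whose Gram matrix
`[(α_i|α_j)n][nk]/n` is invertible, because the `q`-deformed Cartan matrices are nondegenerate for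
`q` not a root of unity. Suitable combinations of the `a_i(n)`, `n > 0`, therefore act as partial
derivatives dual to the `a_i(-n)`. They are locally nilpotent since the degrees of `V` are bounded
above, and Taylor's formula yields `K(k) ⊗ Ω_V ≅ V`. The dressing factors `E_±` cancel the
commutators of `x_i^±(z)` with the `a_j(n)`, so `Z^±(α_i, z)` commutes with the Heisenberg algebra
and preserves its vacuum space `Ω_V`. As `E_±(-α_i, z)` is inverse to `E_±(α_i, z)`, undressing
`Z^±(α_i, z)` recovers `x_i^±(z)`.
-/

noncomputable section

namespace QAff

open PowerSeries (coeff)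

attribute [local instance] LieRing.ofAssociativeRing LieAlgebra.ofAssociativeAlgebra

/-! ### Commutators and exponentials -/

section Commutator

variable {R : Type*} [Ring R]

theorem lie_mul_eq (a b c : R) : ⁅a, b * c⁆ = ⁅a, b⁆ * c + b * ⁅a, c⁆ := by
  simp only [Ring.lie_def]
  noncomm_ring

theorem commute_of_lie_eq_zero {a b : R} (h : ⁅a, b⁆ = 0) : Commute a b :=
  sub_eq_zero.1 h

theorem lie_pow_succ_of_commute {a f : R} (h : Commute ⁅a, f⁆ f) (j : ℕ) :
    ⁅a, f ^ (j + 1)⁆ = ⁅a, f⁆ * ((j + 1) • f ^ j) := by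
  induction j with
  | zero => simp
  | succ j ih =>
    rw [pow_succ f (j + 1), lie_mul_eq, ih, ← (h.pow_right (j + 1)).eq, mul_assoc, smul_mul_assoc,
      ← pow_succ, succ_nsmul _ (j + 1), mul_add]

theorem lie_aeval_of_commute {K : Type*} [CommRing K] [Algebra K R] {a f : R}
    (h : Commute ⁅a, f⁆ f) (P : Polynomial K) :
    ⁅a, Polynomial.aeval f P⁆ = ⁅a, f⁆ * Polynomial.aeval f (Polynomial.derivative P) := by
  induction P using Polynomial.induction_on' with
  | add P Q hP hQ => simp only [map_add, lie_add, hP, hQ, mul_add]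
  | monomial n c =>
    rcases n with _ | n
    · simp [(show Commute a _ from (Algebra.commutes c a).symm).lie_eq]
    · rw [Polynomial.derivative_monomial, Polynomial.aeval_monomial, Polynomial.aeval_monomial,
        ← Algebra.smul_def, ← Algebra.smul_def, lie_smul c a, lie_pow_succ_of_commute h,
        add_tsub_cancel_right, mul_smul_comm, mul_smul_comm, mul_smul, Nat.cast_smul_eq_nsmul]

end Commutator

section PowerSeriesExp

variable {R : Type*} [Ring R]

theorem coeff_pow_mul_eq_zero_of_lt {f : PowerSeries R} (hf : coeff 0 f = 0) (g : PowerSeries R)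
    {n j : ℕ} (h : n < j) : coeff n (f ^ j * g) = 0 := by
  refine PowerSeries.coeff_of_lt_order n ?_
  have hf' : 1 ≤ f.order := PowerSeries.one_le_order_iff_constCoeff_eq_zero.2 (by simpa using hf)
  calc (n : ℕ∞) < j • 1 := by simpa using h
    _ ≤ j • f.order := nsmul_le_nsmul_right hf' j
    _ ≤ (f ^ j).order := PowerSeries.le_order_pow f j
    _ ≤ (f ^ j).order + g.order := le_self_add
    _ ≤ (f ^ j * g).order := PowerSeries.le_order_mul _ _

theorem coeff_pow_eq_zero_of_lt {f : PowerSeries R} (hf : coeff 0 f = 0) {n j : ℕ} (h : n < j) :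
    coeff n (f ^ j) = 0 := by
  simpa using coeff_pow_mul_eq_zero_of_lt hf 1 h

theorem coeff_mul_congr {f f' g g' : PowerSeries R} {n : ℕ}
    (hf : ∀ m ≤ n, coeff m f = coeff m f') (hg : ∀ m ≤ n, coeff m g = coeff m g') :
    coeff n (f * g) = coeff n (f' * g') := by
  rw [PowerSeries.coeff_mul, PowerSeries.coeff_mul]
  refine Finset.sum_congr rfl fun p hp => ?_
  rw [hf _ (Finset.HasAntidiagonal.antidiagonal.fst_le hp),
    hg _ (Finset.HasAntidiagonal.antidiagonal.snd_le hp)]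

variable [Algebra ℂ R]

theorem coeff_aeval_congr {f : PowerSeries R} (hf : coeff 0 f = 0) {n : ℕ} {P Q : Polynomial ℂ}
    (h : ∀ m ≤ n, P.coeff m = Q.coeff m) :
    coeff n (Polynomial.aeval f P) = coeff n (Polynomial.aeval f Q) := by
  obtain ⟨T, hT⟩ : Polynomial.X ^ (n + 1) ∣ P - Q := by
    rw [Polynomial.X_pow_dvd_iff]
    intro m hm
    rw [Polynomial.coeff_sub, h m (Nat.le_of_lt_succ hm), sub_self]
  rw [← sub_eq_zero, ← map_sub, ← map_sub, hT, map_mul, map_pow, Polynomial.aeval_X,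
    coeff_pow_mul_eq_zero_of_lt hf _ n.lt_succ_self]

theorem coeff_psExp {f : PowerSeries R} (hf : coeff 0 f = 0) {n N : ℕ} (h : n < N) :
    coeff n (psExp f) =
      coeff n (Polynomial.aeval f (PowerSeries.trunc N (PowerSeries.exp ℂ))) := by
  have htrunc : ∀ m ≤ n, (PowerSeries.trunc N (PowerSeries.exp ℂ)).coeff m =
      (PowerSeries.trunc (n + 1) (PowerSeries.exp ℂ)).coeff m := fun m hm => by
    rw [PowerSeries.coeff_trunc, PowerSeries.coeff_trunc, if_pos (by lia), if_pos (by lia)]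
  rw [coeff_aeval_congr hf htrunc, Polynomial.aeval_def, PowerSeries.eval₂_trunc_eq_sum_range,
    map_sum, psExp, PowerSeries.coeff_mk]
  refine Finset.sum_congr rfl fun j _ => ?_
  rw [← Algebra.smul_def, PowerSeries.coeff_smul, PowerSeries.coeff_exp]
  simp

theorem coeff_psExp_neg {f : PowerSeries R} (hf : coeff 0 f = 0) {n N : ℕ} (h : n < N) :
    coeff n (psExp (-f)) = coeff n
      (Polynomial.aeval f (PowerSeries.trunc N (PowerSeries.evalNegHom (PowerSeries.exp ℂ)))) := by
  rw [coeff_psExp (by rw [map_neg, hf, neg_zero]) h, Polynomial.aeval_def, Polynomial.aeval_def,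
    PowerSeries.eval₂_trunc_eq_sum_range, PowerSeries.eval₂_trunc_eq_sum_range]
  congr 1
  refine Finset.sum_congr rfl fun j _ => ?_
  rw [← Algebra.smul_def, ← Algebra.smul_def, PowerSeries.evalNegHom, PowerSeries.coeff_rescale]
  rcases j.even_or_odd with hj | hj <;> simp [hj.neg_pow]

theorem psExp_mul_psExp_neg {f : PowerSeries R} (hf : coeff 0 f = 0) :
    psExp f * psExp (-f) = 1 := by
  ext n
  rw [coeff_mul_congr (fun m hm => coeff_psExp hf (Nat.lt_succ_of_le hm))
    (fun m hm => coeff_psExp_neg hf (Nat.lt_succ_of_le hm)), ← map_mul,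
    ← map_one (Polynomial.aeval (R := ℂ) f)]
  refine coeff_aeval_congr hf fun m hm => ?_
  rw [← Polynomial.coeff_coe, Polynomial.coe_mul,
    ← PowerSeries.coeff_mul_eq_coeff_trunc_mul_trunc _ _ (Nat.lt_succ_of_le hm),
    PowerSeries.exp_mul_exp_neg_eq_one, PowerSeries.coeff_one, Polynomial.coeff_one]

theorem lie_psExp_of_commute {a f : PowerSeries R} (hf : coeff 0 f = 0) (h : Commute ⁅a, f⁆ f) :
    ⁅a, psExp f⁆ = ⁅a, f⁆ * psExp f := by
  ext n
  have hcoeff (m : ℕ) (hm : m ≤ n) := coeff_psExp hf (show m < n + 2 by lia)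
  rw [Ring.lie_def, map_sub, coeff_mul_congr (fun _ _ => rfl) hcoeff,
    coeff_mul_congr hcoeff (fun _ _ => rfl), ← map_sub, ← Ring.lie_def, lie_aeval_of_commute h,
    ← PowerSeries.trunc_derivative, PowerSeries.derivative_exp]
  exact coeff_mul_congr (fun _ _ => rfl) fun m hm => (coeff_psExp hf (Nat.lt_succ_of_le hm)).symm

end PowerSeriesExp

section ModeSeries

variable {R : Type*} [Ring R] [Algebra ℂ R]

@[simp]
theorem coeff_zero_modeSeries (c : ℕ+ → ℂ) (b : ℕ+ → R) : coeff 0 (modeSeries c b) = 0 := by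
  simp [modeSeries]

@[simp]
theorem coeff_modeSeries (c : ℕ+ → ℂ) (b : ℕ+ → R) (n : ℕ+) :
    coeff (n : ℕ) (modeSeries c b) = c n • b n := by
  rw [modeSeries, PowerSeries.coeff_mk, dif_pos n.pos]
  rfl

theorem modeSeries_neg (c : ℕ+ → ℂ) (b : ℕ+ → R) :
    modeSeries (fun n => -c n) b = -modeSeries c b := by
  ext n
  simp only [modeSeries, PowerSeries.coeff_mk, map_neg]
  split_ifs <;> simp

theorem lie_C_modeSeries (c : ℕ+ → ℂ) {b : ℕ+ → R} {a : R} {n : ℕ+} {s : ℂ}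
    (h : ∀ m, ⁅a, b m⁆ = if m = n then s • (1 : R) else 0) :
    ⁅PowerSeries.C a, modeSeries c b⁆ = (c n * s) • PowerSeries.X ^ (n : ℕ) := by
  ext m
  rw [Ring.lie_def, map_sub, PowerSeries.coeff_C_mul, PowerSeries.coeff_mul_C, ← Ring.lie_def,
    PowerSeries.coeff_smul, PowerSeries.coeff_X_pow]
  rcases Nat.eq_zero_or_pos m with rfl | hm
  · rw [coeff_zero_modeSeries, lie_zero, if_neg n.pos.ne, smul_zero]
  · lift m to ℕ+ using hm
    rw [coeff_modeSeries, lie_smul, h]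
    simp only [PNat.coe_inj]
    split_ifs with hmn
    · rw [hmn, smul_smul]
    · rw [smul_zero, smul_zero]

theorem lie_coeff_psExp_modeSeries (c : ℕ+ → ℂ) {b : ℕ+ → R} {a : R} {n : ℕ+} {s : ℂ}
    (h : ∀ m, ⁅a, b m⁆ = if m = n then s • (1 : R) else 0) (p : ℕ) :
    ⁅a, coeff p (psExp (modeSeries c b))⁆ =
      if (n : ℕ) ≤ p then (c n * s) • coeff (p - n) (psExp (modeSeries c b)) else 0 := by
  have hlie := lie_C_modeSeries c h
  have hcomm : Commute ⁅PowerSeries.C a, modeSeries c b⁆ (modeSeries c b) := by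
    rw [hlie]
    exact ((PowerSeries.commute_X _).symm.pow_left _).smul_left _
  have hexp := congrArg (coeff p) (lie_psExp_of_commute (coeff_zero_modeSeries c b) hcomm)
  rw [hlie, smul_mul_assoc, PowerSeries.coeff_smul, PowerSeries.coeff_X_pow_mul', smul_ite,
    smul_zero, Ring.lie_def, map_sub, PowerSeries.coeff_C_mul, PowerSeries.coeff_mul_C] at hexp
  exact hexp

theorem commute_coeff_psExp_modeSeries (c : ℕ+ → ℂ) {b : ℕ+ → R} {a : R}
    (h : ∀ m, Commute a (b m)) (p : ℕ) : Commute a (coeff p (psExp (modeSeries c b))) := by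
  have hlie := lie_coeff_psExp_modeSeries c (n := 1) (s := 0)
    (fun m => by rw [(h m).lie_eq, zero_smul, ite_self]) p
  rw [mul_zero, zero_smul, ite_self] at hlie
  exact commute_of_lie_eq_zero hlie

end ModeSeries

section Operators

variable {V W : Type*} [AddCommGroup V] [Module ℂ V] [AddCommGroup W] [Module ℂ W]

theorem coeff_pow_intertwine {F : PowerSeries (Module.End ℂ W)} {G : PowerSeries (Module.End ℂ V)}
    {T : W →ₗ[ℂ] V} (h : ∀ n w, T (coeff n F w) = coeff n G (T w)) (j n : ℕ) (w : W) :
    T (coeff n (F ^ j) w) = coeff n (G ^ j) (T w) := by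
  induction j generalizing n w with
  | zero =>
    simp only [pow_zero, PowerSeries.coeff_one]
    split_ifs <;> simp
  | succ j ih =>
    simp only [pow_succ, PowerSeries.coeff_mul, LinearMap.sum_apply, map_sum, Module.End.mul_apply,
      ih, h]

theorem coeff_psExp_modeSeries_intertwine (c : ℕ+ → ℂ) {b : ℕ+ → Module.End ℂ W}
    {b' : ℕ+ → Module.End ℂ V} {T : W →ₗ[ℂ] V} (h : ∀ n w, T (b n w) = b' n (T w)) (n : ℕ) (w : W) :
    T (coeff n (psExp (modeSeries c b)) w) = coeff n (psExp (modeSeries c b')) (T w) := by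
  have hmode : ∀ n w, T (coeff n (modeSeries c b) w) = coeff n (modeSeries c b') (T w) := by
    intro n w
    rcases Nat.eq_zero_or_pos n with rfl | hn
    · simp
    · lift n to ℕ+ using hn
      simp [h]
  simp only [psExp, PowerSeries.coeff_mk, LinearMap.sum_apply, map_sum, LinearMap.smul_apply,
    map_smul, coeff_pow_intertwine hmode]

theorem coeff_mul_apply_eq_zero {f g : PowerSeries (Module.End ℂ V)} (hf : coeff 0 f = 0) {v : V}
    {n : ℕ} (hg : ∀ m < n, coeff m g v = 0) : coeff n (f * g) v = 0 := by
  rw [PowerSeries.coeff_mul, LinearMap.sum_apply]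
  refine Finset.sum_eq_zero fun p hp => ?_
  rw [Finset.HasAntidiagonal.mem_antidiagonal] at hp
  rw [Module.End.mul_apply]
  rcases Nat.eq_zero_or_pos p.1 with hp1 | hp1
  · rw [hp1, hf, LinearMap.zero_apply]
  · rw [hg _ (by lia), map_zero]

theorem coeff_psExp_apply {f : PowerSeries (Module.End ℂ V)} (hf : coeff 0 f = 0) {v : V} {n : ℕ}
    (h : ∀ m < n, coeff m f v = 0) (hn : n ≠ 0) : coeff n (psExp f) v = coeff n f v := by
  rw [psExp, PowerSeries.coeff_mk, LinearMap.sum_apply, Finset.sum_eq_single 1]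
  · simp
  · intro j _ hj
    rw [LinearMap.smul_apply]
    rcases j with _ | _ | j
    · simp [PowerSeries.coeff_one, hn]
    · exact absurd rfl hj
    · have hpow : coeff 0 (f ^ (j + 1)) = 0 := coeff_pow_eq_zero_of_lt hf j.succ_pos
      rw [pow_succ, coeff_mul_apply_eq_zero hpow h, smul_zero]
  · exact fun h1 => absurd (Finset.mem_range.2 (by lia)) h1

/-- The lowest mode that does not kill `v` would appear linearly in `exp`. -/
theorem coeff_psExp_modeSeries_apply_iff {c : ℕ+ → ℂ} (hc : ∀ n, c n ≠ 0)
    {b : ℕ+ → Module.End ℂ V} {v : V} :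
    (∀ n, coeff n (psExp (modeSeries c b)) v = if n = 0 then v else 0) ↔ ∀ n, b n v = 0 := by
  have hzero := coeff_zero_modeSeries c b
  constructor
  · intro h n
    suffices H : ∀ n : ℕ, coeff n (modeSeries c b) v = 0 by simpa [hc n] using H n
    intro n
    induction n using Nat.strong_induction_on with
    | _ n ih =>
      rcases eq_or_ne n 0 with rfl | hn
      · rw [hzero, LinearMap.zero_apply]
      · rw [← coeff_psExp_apply hzero ih hn, h n, if_neg hn]
  · intro h n
    have hmode : ∀ m : ℕ, coeff m (modeSeries c b) v = 0 := fun m => by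
      rcases Nat.eq_zero_or_pos m with rfl | hm
      · rw [hzero, LinearMap.zero_apply]
      · lift m to ℕ+ using hm
        rw [coeff_modeSeries, LinearMap.smul_apply, h, smul_zero]
    rcases eq_or_ne n 0 with rfl | hn
    · simp [psExp]
    · rw [coeff_psExp_apply hzero (fun m _ => hmode m) hn, hmode, if_neg hn]

end Operators

/-! ### `q`-numbers -/

section QNumbers

variable (ħ : ℂ)

theorem qpow_ne_zero (a : ℚ) : qpow ħ a ≠ 0 := Complex.exp_ne_zero _

theorem qpow_neg (a : ℚ) : qpow ħ (-a) = (qpow ħ a)⁻¹ := by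
  rw [qpow, qpow, ← Complex.exp_neg]
  push_cast
  ring_nf

theorem qpow_nat_mul (n : ℕ) (a : ℚ) : qpow ħ (n * a) = qpow ħ a ^ n := by
  rw [qpow, qpow, ← Complex.exp_nat_mul]
  push_cast
  ring_nf

@[simp]
theorem qnum_zero : qnum ħ 0 = 0 := by simp [qnum]

theorem qnum_neg (a : ℚ) : qnum ħ (-a) = -qnum ħ a := by
  rw [qnum, qnum, neg_neg]
  ring

theorem qnum_two_mul (a : ℚ) : qnum ħ (2 * a) = (qpow ħ a + (qpow ħ a)⁻¹) * qnum ħ a := by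
  have h : qpow ħ (2 * a) = qpow ħ a ^ 2 := mod_cast qpow_nat_mul ħ 2 a
  rw [qnum, qnum, qpow_neg ħ (2 * a), h, qpow_neg ħ a]
  ring

theorem qnum_three_mul (a : ℚ) :
    qnum ħ (3 * a) = (qpow ħ a ^ 2 + 1 + (qpow ħ a ^ 2)⁻¹) * qnum ħ a := by
  have h : qpow ħ (3 * a) = qpow ħ a ^ 3 := mod_cast qpow_nat_mul ħ 3 a
  have h0 := qpow_ne_zero ħ a
  rw [qnum, qnum, qpow_neg ħ (3 * a), qpow_neg ħ a, h]
  field_simp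
  ring

variable {ħ} (hq : ∀ n : ℕ, 0 < n → Complex.exp ħ ^ n ≠ 1)
include hq

theorem qpow_ne_one {a : ℚ} (ha : a ≠ 0) : qpow ħ a ≠ 1 := by
  intro h
  have qpow_num : qpow ħ (a.num : ℚ) = 1 := by
    rw [← Rat.mul_den_eq_num, mul_comm, qpow_nat_mul, h, one_pow]
  have qpow_natAbs : qpow ħ (a.num.natAbs : ℚ) = 1 := by
    rcases Int.natAbs_eq a.num with ha' | ha' <;> rw [ha'] at qpow_num
    · rwa [Int.cast_natCast] at qpow_num
    · rwa [Int.cast_neg, Int.cast_natCast, qpow_neg, inv_eq_one] at qpow_num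
  refine hq a.num.natAbs (Int.natAbs_pos.2 (Rat.num_ne_zero.2 ha)) ?_
  rw [← Complex.exp_nat_mul]
  simpa only [qpow, Rat.cast_natCast] using qpow_natAbs

theorem qpow_pow_ne_one {a : ℚ} (ha : a ≠ 0) {n : ℕ} (hn : 0 < n) : qpow ħ a ^ n ≠ 1 := by
  rw [← qpow_nat_mul]
  exact qpow_ne_one hq (mul_ne_zero (mod_cast hn.ne') ha)

theorem qpow_sub_qpow_neg_ne_zero {a : ℚ} (ha : a ≠ 0) : qpow ħ a - qpow ħ (-a) ≠ 0 := by
  intro h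
  rw [qpow_neg, sub_eq_zero, ← mul_eq_one_iff_eq_inv₀ (qpow_ne_zero ħ a), ← pow_two] at h
  exact qpow_pow_ne_one hq ha two_pos h

theorem qnum_ne_zero {a : ℚ} (ha : a ≠ 0) : qnum ħ a ≠ 0 :=
  div_ne_zero (qpow_sub_qpow_neg_ne_zero hq ha) (qpow_sub_qpow_neg_ne_zero hq one_ne_zero)

end QNumbers

/-! ### Nondegeneracy of the `q`-deformed Cartan matrices -/

section Chains

variable {K : Type*} [Field K] {y : K}

/-- `y` is nonzero and not a root of unity. -/
structure IsGeneric (y : K) : Prop where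
  ne_zero : y ≠ 0
  pow_ne_one : ∀ n : ℕ, 0 < n → y ^ n ≠ 1

theorem IsGeneric.pow_ne_neg_one (hy : IsGeneric y) {n : ℕ} (hn : 0 < n) : y ^ n ≠ -1 := by
  intro h
  refine hy.pow_ne_one (n * 2) (by positivity) ?_
  rw [pow_mul, h, neg_one_sq]

/-- The unnormalized quantum integer `y ^ n - y ^ (-n)`. -/
def bracket (y : K) (n : ℕ) : K := y ^ n - y⁻¹ ^ n

@[simp]
theorem bracket_zero : bracket y 0 = 0 := by simp [bracket]

theorem bracket_add_two (hy : y ≠ 0) (n : ℕ) :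
    bracket y (n + 2) = (y + y⁻¹) * bracket y (n + 1) - bracket y n := by
  simp only [bracket, pow_succ]
  field_simp
  ring

theorem bracket_ne_zero (hy : IsGeneric y) {n : ℕ} (hn : 0 < n) : bracket y n ≠ 0 := by
  intro h
  have h0 := pow_ne_zero n hy.ne_zero
  rw [bracket, sub_eq_zero, inv_pow, ← mul_eq_one_iff_eq_inv₀ h0, ← pow_add] at h
  exact hy.pow_ne_one _ (by omega) h

theorem bracket_succ_sub_bracket_ne_zero (hy : IsGeneric y) (n : ℕ) :
    bracket y (n + 1) - bracket y n ≠ 0 := by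
  have hy0 := hy.ne_zero
  have factored : bracket y (n + 1) - bracket y n =
      (y - 1) * ((y ^ (2 * n + 1) + 1) * y⁻¹ ^ (n + 1)) := by
    simp only [bracket, inv_pow]
    field_simp
    ring
  have hy1 : y - 1 ≠ 0 := sub_ne_zero.2 fun h => hy.pow_ne_one 1 one_pos (by rw [h, one_pow])
  rw [factored]
  refine mul_ne_zero hy1 (mul_ne_zero (fun h => ?_) (pow_ne_zero _ (inv_ne_zero hy0)))
  exact hy.pow_ne_neg_one (by omega) (eq_neg_of_add_eq_zero_left h)

/-- Values `w 1, …, w N` along a leg of length `N` of a Dynkin diagram, counted from the tip, that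
are annihilated by the `q`-deformed Cartan matrix at all nodes but the last. -/
structure IsLegChain (y : K) (N : ℕ) (w : ℕ → K) : Prop where
  zero : w 0 = 0
  step : ∀ n, n + 1 < N → (y + y⁻¹) * w (n + 1) = w n + w (n + 2)

namespace IsLegChain

variable {N : ℕ} {w : ℕ → K}

theorem bracket_one_mul (hy : y ≠ 0) (hw : IsLegChain y N w) {n : ℕ} (hn : n ≤ N) :
    bracket y 1 * w n = bracket y n * w 1 := by
  induction n using Nat.strong_induction_on with
  | _ n ih =>
    match n with
    | 0 => simp [hw.zero]
    | 1 => rfl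
    | n + 2 =>
      rw [bracket_add_two hy]
      linear_combination (y + y⁻¹) * ih (n + 1) (by omega) (by omega) -
        ih n (by omega) (by omega) - bracket y 1 * hw.step n (by omega)

theorem bracket_mul_eq (hy : IsGeneric y) (hw : IsLegChain y N w) {m n : ℕ} (hm : m ≤ N)
    (hn : n ≤ N) : bracket y n * w m = bracket y m * w n := by
  refine mul_left_cancel₀ (bracket_ne_zero hy one_pos) ?_
  linear_combination bracket y n * hw.bracket_one_mul hy.ne_zero hm -
    bracket y m * hw.bracket_one_mul hy.ne_zero hn

theorem eq_zero (hy : IsGeneric y) (hw : IsLegChain y N w) {m n : ℕ} (hm : m ≤ N) (hn : n ≤ N)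
    (hn0 : 0 < n) (h : w n = 0) : w m = 0 := by
  have := hw.bracket_mul_eq hy hm hn
  rw [h, mul_zero] at this
  exact (mul_eq_zero.1 this).resolve_left (bracket_ne_zero hy hn0)

end IsLegChain

/-- Up to a nonzero factor, the determinant of the `q`-deformed Cartan matrix of the star-shaped
diagram `T_{p,q,r}`, whose legs have `p`, `q`, `r` nodes including the common one. Meaningful only
for positive `p`, `q`, `r`, as the subtraction truncates. -/
def starDet (y : K) (p q r : ℕ) : K :=
  (y + y⁻¹) * (bracket y p * bracket y q * bracket y r) -
    (bracket y (p - 1) * bracket y q * bracket y r + bracket y p * bracket y (q - 1) * bracket y r +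
      bracket y p * bracket y q * bracket y (r - 1))

section Star

variable {p q r : ℕ} {u v w : ℕ → K}

theorem star_center_eq_zero (hy : IsGeneric y) (hu : IsLegChain y p u) (hv : IsLegChain y q v)
    (hw : IsLegChain y r w) (huv : u p = v q) (huw : u p = w r)
    (hc : (y + y⁻¹) * u p = u (p - 1) + v (q - 1) + w (r - 1)) (hdet : starDet y p q r ≠ 0) :
    u p = 0 := by
  have hp := hu.bracket_mul_eq hy (Nat.sub_le p 1) le_rfl
  have hq := hv.bracket_mul_eq hy (Nat.sub_le q 1) le_rfl
  have hr := hw.bracket_mul_eq hy (Nat.sub_le r 1) le_rfl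
  rw [← huv] at hq
  rw [← huw] at hr
  refine (mul_eq_zero.1 ?_).resolve_left hdet
  rw [starDet]
  linear_combination bracket y p * bracket y q * bracket y r * hc +
    bracket y q * bracket y r * hp + bracket y p * bracket y r * hq +
    bracket y p * bracket y q * hr

theorem star_eq_zero (hy : IsGeneric y) (hp : 0 < p) (hq : 0 < q) (hr : 0 < r)
    (hu : IsLegChain y p u) (hv : IsLegChain y q v) (hw : IsLegChain y r w) (huv : u p = v q)
    (huw : u p = w r) (hc : (y + y⁻¹) * u p = u (p - 1) + v (q - 1) + w (r - 1))
    (hdet : starDet y p q r ≠ 0) :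
    (∀ n ≤ p, u n = 0) ∧ (∀ n ≤ q, v n = 0) ∧ ∀ n ≤ r, w n = 0 := by
  have center := star_center_eq_zero hy hu hv hw huv huw hc hdet
  exact ⟨fun n hn => hu.eq_zero hy hn le_rfl hp center,
    fun n hn => hv.eq_zero hy hn le_rfl hq (huv ▸ center),
    fun n hn => hw.eq_zero hy hn le_rfl hr (huw ▸ center)⟩

end Star

theorem starDet_two_two (hy : y ≠ 0) {r : ℕ} (hr : 0 < r) :
    starDet y 2 2 r =
      (y + y⁻¹) * (y - y⁻¹) ^ 3 * (y ^ (r + 1) + y⁻¹ ^ (r + 1)) := by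
  obtain ⟨r, rfl⟩ := Nat.exists_eq_add_one.2 hr
  simp only [starDet, bracket, Nat.add_one_sub_one, pow_succ, pow_zero, one_mul]
  field_simp
  ring

theorem starDet_two_two_ne_zero (hy : IsGeneric y) {r : ℕ} (hr : 0 < r) :
    starDet y 2 2 r ≠ 0 := by
  have pow_add_inv_pow_ne_zero (n : ℕ) (hn : 0 < n) : y ^ n + y⁻¹ ^ n ≠ 0 := by
    intro h
    have h0 := pow_ne_zero n hy.ne_zero
    refine hy.pow_ne_neg_one (n := n + n) (by omega) ?_
    rw [inv_pow] at h
    rw [pow_add]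
    field_simp at h
    linear_combination h
  rw [starDet_two_two hy.ne_zero hr]
  refine mul_ne_zero (mul_ne_zero ?_ (pow_ne_zero 3 ?_)) (pow_add_inv_pow_ne_zero _ r.succ_pos)
  · simpa only [pow_one] using pow_add_inv_pow_ne_zero 1 one_pos
  · simpa only [bracket, pow_one] using bracket_ne_zero hy one_pos

theorem starDet_two_three_three_ne_zero (hy : IsGeneric y) : starDet y 2 3 3 ≠ 0 := by
  have hy0 := hy.ne_zero
  have factored : starDet y 2 3 3 =
      bracket y 1 ^ 2 * bracket y 3 * ((y ^ 8 - y ^ 4 + 1) * y⁻¹ ^ 4) := by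
    simp only [starDet, bracket, Nat.add_one_sub_one]
    field_simp
    ring
  rw [factored]
  refine mul_ne_zero (mul_ne_zero (pow_ne_zero 2 (bracket_ne_zero hy one_pos))
    (bracket_ne_zero hy three_pos)) (mul_ne_zero (fun h => ?_) (pow_ne_zero 4 (inv_ne_zero hy0)))
  exact hy.pow_ne_neg_one (n := 12) (by norm_num) (by linear_combination (y ^ 4 + 1) * h)

theorem starDet_two_three_four_ne_zero (hy : IsGeneric y) : starDet y 2 3 4 ≠ 0 := by
  have hy0 := hy.ne_zero
  have factored : starDet y 2 3 4 =
      bracket y 1 ^ 2 * bracket y 2 * ((y ^ 12 - y ^ 6 + 1) * y⁻¹ ^ 6) := by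
    simp only [starDet, bracket, Nat.add_one_sub_one]
    field_simp
    ring
  rw [factored]
  refine mul_ne_zero (mul_ne_zero (pow_ne_zero 2 (bracket_ne_zero hy one_pos))
    (bracket_ne_zero hy two_pos)) (mul_ne_zero (fun h => ?_) (pow_ne_zero 6 (inv_ne_zero hy0)))
  exact hy.pow_ne_neg_one (n := 18) (by norm_num) (by linear_combination (y ^ 6 + 1) * h)

theorem starDet_two_three_five_ne_zero (hy : IsGeneric y) : starDet y 2 3 5 ≠ 0 := by
  have hy0 := hy.ne_zero
  have factored : starDet y 2 3 5 = bracket y 1 ^ 3 *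
      ((y ^ 16 + y ^ 14 - y ^ 10 - y ^ 8 - y ^ 6 + y ^ 2 + 1) * y⁻¹ ^ 8) := by
    simp only [starDet, bracket, Nat.add_one_sub_one]
    field_simp
    ring
  rw [factored]
  refine mul_ne_zero (pow_ne_zero 3 (bracket_ne_zero hy one_pos))
    (mul_ne_zero (fun h => ?_) (pow_ne_zero 8 (inv_ne_zero hy0)))
  exact hy.pow_ne_neg_one (n := 30) (by norm_num) (by
    linear_combination (y ^ 14 - y ^ 12 + y ^ 10 + y ^ 4 - y ^ 2 + 1) * h)

theorem eq_zero_of_F4_relations (hy : IsGeneric y) {v : Fin 4 → K}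
    (r0 : (y ^ 2 + (y ^ 2)⁻¹) * v 0 = v 1) (r1 : (y ^ 2 + (y ^ 2)⁻¹) * v 1 = v 0 + v 2)
    (r2 : (y + y⁻¹) * v 2 = (y + y⁻¹) * v 1 + v 3) (r3 : (y + y⁻¹) * v 3 = v 2) : v = 0 := by
  have hy0 := hy.ne_zero
  have hR : (y + y⁻¹) ^ 2 = y ^ 2 + (y ^ 2)⁻¹ + 2 := by
    field_simp
    ring
  set R := y ^ 2 + (y ^ 2)⁻¹ with hR_def
  have hdet : R ^ 3 - 3 * R - 1 ≠ 0 := by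
    have expand : (R ^ 3 - 3 * R - 1) * y ^ 6 = y ^ 12 - y ^ 6 + 1 := by
      rw [hR_def]
      field_simp
      ring
    exact fun hz => hy.pow_ne_neg_one (n := 18) (by norm_num) <| by
      linear_combination (y ^ 6 + 1) * (y ^ 6 * hz - expand)
  have v0 : v 0 = 0 := (mul_eq_zero.1 (by
    linear_combination (y + y⁻¹) * r2 + r3 + (v 1 - v 2) * hR - (R + 1) * (-R * r0 - r1) -
      (R + 2) * r0 : (R ^ 3 - 3 * R - 1) * v 0 = 0)).resolve_left hdet
  have v1 : v 1 = 0 := by rw [← r0, v0, mul_zero]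
  have v2 : v 2 = 0 := by linear_combination -r1 + R * v1 - v0
  have v3 : v 3 = 0 := by linear_combination -r2 + (y + y⁻¹) * (v2 - v1)
  ext i
  fin_cases i <;> assumption

end Chains

section Padding

variable {l : ℕ} (v : Fin l → ℂ)

/-- The vector `v` as a function on `ℕ` with `pad v (j + 1) = v j`, extended by zero. -/
def pad (n : ℕ) : ℂ := ∑ j : Fin l, if (j : ℕ) + 1 = n then v j else 0

@[simp]
theorem pad_zero : pad v 0 = 0 := by simp [pad]

@[simp]
theorem pad_succ (i : Fin l) : pad v (i + 1) = v i := by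
  simp [pad, Fin.val_inj]

theorem pad_eq_zero_of_lt {n : ℕ} (hn : l < n) : pad v n = 0 :=
  Finset.sum_eq_zero fun j _ => if_neg (by omega)

variable {v}

theorem eq_zero_of_pad (h : ∀ n ≤ l, pad v n = 0) : v = 0 :=
  funext fun i => by rw [← pad_succ v i, h _ (by omega), Pi.zero_apply]

theorem sum_mul_eq_sum_pad {f : Fin l → ℂ} (s : Finset ℕ) (c : ℕ → ℂ)
    (hf : ∀ j : Fin l, f j = if (j : ℕ) + 1 ∈ s then c (j + 1) else 0) :
    ∑ j, f j * v j = ∑ m ∈ s, c m * pad v m := by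
  simp only [pad, Finset.mul_sum]
  rw [Finset.sum_comm]
  refine Finset.sum_congr rfl fun j _ => ?_
  simp only [hf, mul_ite, mul_zero, Finset.sum_ite_eq, ite_mul, zero_mul]

theorem sum_ite_eq_sum_pad {p : Fin l → Prop} [DecidablePred p] (s : Finset ℕ)
    (hp : ∀ j : Fin l, p j ↔ (j : ℕ) + 1 ∈ s) :
    ∑ j, (if p j then v j else 0) = ∑ m ∈ s, pad v m := by
  simpa only [ite_mul, one_mul, zero_mul, Pi.one_apply] using sum_mul_eq_sum_pad (v := v)
    (f := fun j => if p j then 1 else 0) s 1 fun j => by simp only [hp, Pi.one_apply]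

end Padding

theorem cartan_A_apply {l : ℕ} (hl : 1 ≤ l) (i j : Fin l) : (SimpleType.A l hl).cartan i j =
    if i = j then 2 else if (i : ℕ) + 1 = j ∨ (j : ℕ) + 1 = i then -1 else 0 := by
  simp only [SimpleType.cartan, CartanMatrix.A_transpose]
  rfl

theorem form_B_apply {l : ℕ} (hl : 2 ≤ l) (i j : Fin l) : (SimpleType.B l hl).form i j =
    if i = j then if (i : ℕ) + 1 = l then 1 else 2
    else if (i : ℕ) + 1 = j ∨ (j : ℕ) + 1 = i then -1 else 0 := by
  simp only [SimpleType.form, SimpleType.cartan, SimpleType.dd, CartanMatrix.B_transpose,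
    CartanMatrix.C, Matrix.of_apply, Fin.ext_iff]
  push_cast
  grind

theorem form_C_apply {l : ℕ} (hl : 2 ≤ l) (i j : Fin l) : (SimpleType.C l hl).form i j =
    if i = j then if (i : ℕ) + 1 = l then 2 else 1
    else if (i : ℕ) + 1 = j ∨ (j : ℕ) + 1 = i then
      if (i : ℕ) + 1 = l ∨ (j : ℕ) + 1 = l then -1 else -1 / 2
    else 0 := by
  simp only [SimpleType.form, SimpleType.cartan, SimpleType.dd, CartanMatrix.C_transpose,
    CartanMatrix.B, Matrix.of_apply, Fin.ext_iff]
  push_cast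
  grind

theorem cartan_D_apply {l : ℕ} (hl : 4 ≤ l) (i j : Fin l) : (SimpleType.D l hl).cartan i j =
    if i = j then 2
    else if (i : ℕ) + 1 = j ∧ (j : ℕ) + 2 < l ∨ (j : ℕ) + 1 = i ∧ (i : ℕ) + 2 < l ∨
      (i : ℕ) + 3 = l ∧ l ≤ (j : ℕ) + 2 ∨ (j : ℕ) + 3 = l ∧ l ≤ (i : ℕ) + 2 then -1
    else 0 := by
  simp only [SimpleType.cartan, Matrix.transpose_apply, CartanMatrix.D, Matrix.of_apply,
    Fin.ext_iff]
  grind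

section Nondegenerate

variable {ħ : ℂ} (hq : ∀ n : ℕ, 0 < n → Complex.exp ħ ^ n ≠ 1) {t : ℚ} (ht : t ≠ 0)
  {l : ℕ} {v : Fin l → ℂ}
include hq ht

theorem isGeneric_qpow : IsGeneric (qpow ħ t) :=
  ⟨qpow_ne_zero ħ t, fun _ hn => qpow_pow_ne_one hq ht hn⟩

theorem mul_eq_sum_neighbours {M : Matrix (Fin l) (Fin l) ℤ} {i : Fin l}
    (hi : M i i = 2) (hM : ∀ j, j = i ∨ M i j = 0 ∨ M i j = -1)
    (h : ∑ j, qnum ħ (1 * (M i j : ℚ) * t) * v j = 0) :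
    (qpow ħ t + (qpow ħ t)⁻¹) * v i = ∑ j, if M i j = -1 then v j else 0 := by
  have split (j : Fin l) : qnum ħ (1 * (M i j : ℚ) * t) * v j =
      qnum ħ t * ((if j = i then (qpow ħ t + (qpow ħ t)⁻¹) * v i else 0) -
        if M i j = -1 then v j else 0) := by
    by_cases hj : j = i
    · rw [hj, hi, if_pos rfl, if_neg (by decide), one_mul, Int.cast_ofNat, qnum_two_mul]
      ring
    · rcases (hM j).resolve_left hj with h0 | h1
      · simp [h0, hj]
      · simp [h1, hj, qnum_neg]
  rw [Finset.sum_congr rfl fun j _ => split j, ← Finset.mul_sum, Finset.sum_sub_distrib] at h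
  have := (mul_eq_zero.1 h).resolve_left (qnum_ne_zero hq ht)
  rwa [Finset.sum_ite_eq' Finset.univ i, if_pos (Finset.mem_univ i), sub_eq_zero] at this

theorem eq_zero_of_form_A (hl : 1 ≤ l)
    (h : ∀ i, ∑ j, qnum ħ ((SimpleType.A l hl).form i j * t) * v j = 0) : v = 0 := by
  have hchain : IsLegChain (qpow ħ t) (l + 1) (pad v) := by
    refine ⟨pad_zero v, fun n hn => ?_⟩
    obtain ⟨i, rfl⟩ : ∃ i : Fin l, n = i := ⟨⟨n, by omega⟩, rfl⟩
    have hM := cartan_A_apply hl i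
    rw [pad_succ, mul_eq_sum_neighbours hq ht (by simp [hM]) (by grind) (h i),
      sum_ite_eq_sum_pad {(i : ℕ), (i : ℕ) + 2} (by grind), Finset.sum_pair (by omega)]
  exact eq_zero_of_pad fun n hn => hchain.eq_zero (isGeneric_qpow hq ht) (by omega) le_rfl
    l.succ_pos (pad_eq_zero_of_lt v l.lt_succ_self)

theorem eq_zero_of_form_B (hl : 2 ≤ l)
    (h : ∀ i, ∑ j, qnum ħ ((SimpleType.B l hl).form i j * t) * v j = 0) : v = 0 := by
  have hy := isGeneric_qpow hq ht
  have row (n : ℕ) (hn : n < l) : qnum ħ ((if n + 1 = l then 1 else 2) * t) * pad v (n + 1) =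
      qnum ħ t * (pad v n + pad v (n + 2)) := by
    rw [← sub_eq_zero, ← h ⟨n, hn⟩, sum_mul_eq_sum_pad {n, n + 1, n + 2}
      (fun m => if m = n + 1 then qnum ħ ((if n + 1 = l then 1 else 2) * t) else -qnum ħ t)
      fun j => by
        simp only [form_B_apply, Fin.ext_iff, ite_mul, neg_mul, one_mul, zero_mul,
          apply_ite (qnum ħ), qnum_neg, qnum_zero]
        grind]
    rw [Finset.sum_insert (by simp), Finset.sum_pair (by simp)]
    grind
  obtain ⟨r, rfl⟩ := Nat.exists_eq_add_of_le' (one_le_two.trans hl)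
  have hchain : IsLegChain (qpow ħ t) (r + 1) (pad v) := ⟨pad_zero v, fun n hn => by
    refine mul_left_cancel₀ (qnum_ne_zero hq ht) ?_
    rw [← row n (by omega), if_neg (by omega), qnum_two_mul]
    ring⟩
  have hlast : pad v (r + 1) = pad v r := by
    refine mul_left_cancel₀ (qnum_ne_zero hq ht) ?_
    simpa [pad_eq_zero_of_lt v (r + 1).lt_succ_self] using row r (by omega)
  have hr := hchain.bracket_mul_eq hy r.le_succ le_rfl
  rw [← hlast, ← sub_eq_zero, ← sub_mul] at hr
  have hpad : pad v (r + 1) = 0 :=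
    (mul_eq_zero.1 hr).resolve_left (bracket_succ_sub_bracket_ne_zero hy r)
  exact eq_zero_of_pad fun n hn => hchain.eq_zero hy hn le_rfl r.succ_pos hpad

omit hq ht in
theorem row_eq_of_form_C {u : ℚ} (hl : 2 ≤ l) {n : ℕ} (hn : n < l)
    (h : ∑ j, qnum ħ ((SimpleType.C l hl).form ⟨n, hn⟩ j * (2 * u)) * v j = 0) :
    (if n + 1 = l then qnum ħ (2 * (2 * u)) else qnum ħ (2 * u)) * pad v (n + 1) =
      (if n + 1 = l then qnum ħ (2 * u) else qnum ħ u) * pad v n +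
        (if n + 2 = l then qnum ħ (2 * u) else qnum ħ u) * pad v (n + 2) := by
  have half : -1 / 2 * (2 * u) = -u := by ring
  rw [← sub_eq_zero, ← h, sum_mul_eq_sum_pad {n, n + 1, n + 2}
    (fun m => if m = n + 1 then if n + 1 = l then qnum ħ (2 * (2 * u)) else qnum ħ (2 * u) else
      if m = n then -if n + 1 = l then qnum ħ (2 * u) else qnum ħ u else
      -if n + 2 = l then qnum ħ (2 * u) else qnum ħ u)
    fun j => by
      simp only [form_C_apply, Fin.ext_iff, ite_mul, half, neg_mul, one_mul, zero_mul,
        apply_ite (qnum ħ), qnum_neg, qnum_zero]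
      grind]
  rw [Finset.sum_insert (by simp), Finset.sum_pair (by simp)]
  grind

theorem eq_zero_of_form_C (hl : 2 ≤ l)
    (h : ∀ i, ∑ j, qnum ħ ((SimpleType.C l hl).form i j * t) * v j = 0) : v = 0 := by
  obtain ⟨u, rfl⟩ : ∃ u, t = 2 * u := ⟨t / 2, by ring⟩
  have hu : u ≠ 0 := right_ne_zero_of_mul ht
  have hy := isGeneric_qpow hq hu
  obtain ⟨r, rfl⟩ := Nat.exists_eq_add_of_le' hl
  have hy2 : qpow ħ (2 * u) = qpow ħ u ^ 2 := mod_cast qpow_nat_mul ħ 2 u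
  have hlast : (qpow ħ u ^ 2 + (qpow ħ u ^ 2)⁻¹) * pad v (r + 2) = pad v (r + 1) := by
    refine mul_left_cancel₀ (qnum_ne_zero hq ht) ?_
    have := row_eq_of_form_C hl (by omega : r + 1 < r + 2) (h _)
    rw [if_pos rfl, if_pos rfl, pad_eq_zero_of_lt v (r + 2).lt_succ_self, qnum_two_mul,
      hy2] at this
    linear_combination this
  set y := qpow ħ u
  set w : ℕ → ℂ := fun n => if n = r + 2 then (y + y⁻¹) * pad v n else pad v n with hw_def
  have hw : IsLegChain y (r + 2) w := by
    refine ⟨by simp [w], fun n hn => mul_left_cancel₀ (qnum_ne_zero hq hu) ?_⟩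
    have := row_eq_of_form_C hl (by omega : n < r + 2) (h _)
    rw [if_neg (by omega), if_neg (by omega), qnum_two_mul] at this
    simp only [hw_def]
    rw [if_neg (by omega), if_neg (by omega)]
    split_ifs at this ⊢ <;> linear_combination this
  -- Folding: `C_{r+2}` is the quotient of `D_{r+3}` by its involution, and the long root unfolds to
  -- the two short legs of the star.
  have hleg : IsLegChain y 2 fun n => [0, pad v (r + 2), (y + y⁻¹) * pad v (r + 2)].getD n 0 :=
    ⟨rfl, fun n hn => by
      obtain rfl : n = 0 := (by omega)
      simp⟩
  have hc : (y + y⁻¹) * ((y + y⁻¹) * pad v (r + 2)) =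
      pad v (r + 2) + pad v (r + 2) + pad v (r + 1) := by
    have := hy.ne_zero
    rw [← hlast]
    field_simp
    ring
  obtain ⟨v0, -, w0⟩ := star_eq_zero (r := r + 2) hy two_pos two_pos (by omega) hleg hleg hw rfl
    (if_pos rfl).symm (hc.trans (by simp [w])) (starDet_two_two_ne_zero hy (by omega))
  refine eq_zero_of_pad fun n hn => ?_
  obtain rfl | hn' := eq_or_ne n (r + 2)
  exacts [v0 1 one_le_two, by simpa only [hw_def, if_neg hn'] using w0 n hn]

theorem eq_zero_of_form_D (hl : 4 ≤ l)
    (h : ∀ i, ∑ j, qnum ħ ((SimpleType.D l hl).form i j * t) * v j = 0) : v = 0 := by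
  have hy := isGeneric_qpow hq ht
  have row (n : ℕ) (hn : n < l) (s : Finset ℕ)
      (hs : ∀ j : Fin l, (SimpleType.D l hl).cartan ⟨n, hn⟩ j = -1 ↔ (j : ℕ) + 1 ∈ s) :
      (qpow ħ t + (qpow ħ t)⁻¹) * pad v (n + 1) = ∑ m ∈ s, pad v m := by
    have hM := cartan_D_apply hl ⟨n, hn⟩
    rw [pad_succ v ⟨n, hn⟩, mul_eq_sum_neighbours hq ht (by simp [hM]) (by grind) (h ⟨n, hn⟩),
      sum_ite_eq_sum_pad s hs]
  obtain ⟨r, rfl⟩ := Nat.exists_eq_add_of_le' hl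
  simp only [cartan_D_apply, Fin.ext_iff] at row
  have hw : IsLegChain (qpow ħ t) (r + 2) (pad v) := ⟨pad_zero v, fun n hn => by
    rw [row n (by omega) {n, n + 2} (by grind), Finset.sum_pair (by omega)]⟩
  have hu : IsLegChain (qpow ħ t) 2 fun n => [0, pad v (r + 3), pad v (r + 2)].getD n 0 :=
    ⟨rfl, fun n hn => by
      obtain rfl : n = 0 := (by omega)
      simpa using row (r + 2) (by omega) {r + 2} (by grind)⟩
  have hv : IsLegChain (qpow ħ t) 2 fun n => [0, pad v (r + 4), pad v (r + 2)].getD n 0 :=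
    ⟨rfl, fun n hn => by
      obtain rfl : n = 0 := (by omega)
      simpa using row (r + 3) (by omega) {r + 2} (by grind)⟩
  have hc : (qpow ħ t + (qpow ħ t)⁻¹) * pad v (r + 2) =
      pad v (r + 3) + pad v (r + 4) + pad v (r + 1) := by
    rw [row (r + 1) (by omega) {r + 3, r + 4, r + 1} (by grind)]
    simp [add_assoc]
  obtain ⟨u0, v0, w0⟩ := star_eq_zero hy two_pos two_pos (by omega) hu hv hw rfl rfl hc
    (starDet_two_two_ne_zero hy (by omega))
  refine eq_zero_of_pad fun n hn => ?_
  obtain hn | rfl | rfl : n ≤ r + 2 ∨ n = r + 3 ∨ n = r + 4 := by omega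
  exacts [w0 n hn, u0 1 one_le_two, v0 1 one_le_two]

theorem eq_zero_of_form_E6 {v : Fin 6 → ℂ}
    (h : ∀ i : Fin 6, ∑ j : Fin 6, qnum ħ (SimpleType.E6.form i j * t) * v j = 0) : v = 0 := by
  have hy := isGeneric_qpow hq ht
  have row (i : Fin 6) := mul_eq_sum_neighbours hq ht (M := CartanMatrix.E₆.transpose)
    (by decide +revert) (by fin_cases i <;> decide) (h i)
  have hu : IsLegChain (qpow ħ t) 2 fun n => [0, v 1, v 3].getD n 0 :=
    ⟨rfl, fun n hn => by
      obtain rfl : n = 0 := (by omega)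
      simpa [Fin.sum_univ_succ, CartanMatrix.E₆] using row 1⟩
  have hv : IsLegChain (qpow ħ t) 3 fun n => [0, v 0, v 2, v 3].getD n 0 :=
    ⟨rfl, fun n hn => by
      obtain rfl | rfl : n = 0 ∨ n = 1 := (by omega)
      · simpa [Fin.sum_univ_succ, CartanMatrix.E₆] using row 0
      · simpa [Fin.sum_univ_succ, CartanMatrix.E₆] using row 2⟩
  have hw : IsLegChain (qpow ħ t) 3 fun n => [0, v 5, v 4, v 3].getD n 0 :=
    ⟨rfl, fun n hn => by
      obtain rfl | rfl : n = 0 ∨ n = 1 := (by omega)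
      · simpa [Fin.sum_univ_succ, CartanMatrix.E₆, add_comm] using row 5
      · simpa [Fin.sum_univ_succ, CartanMatrix.E₆, add_comm] using row 4⟩
  have hc : (qpow ħ t + (qpow ħ t)⁻¹) * v 3 = v 1 + v 2 + v 4 := by
    simpa [Fin.sum_univ_succ, CartanMatrix.E₆, add_assoc] using row 3
  obtain ⟨u0, v0, w0⟩ := star_eq_zero hy two_pos three_pos (by norm_num) hu hv hw rfl rfl hc
    (starDet_two_three_three_ne_zero hy)
  ext i
  fin_cases i
  exacts [v0 1 (by norm_num), u0 1 (by norm_num), v0 2 (by norm_num), v0 3 le_rfl,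
    w0 2 (by norm_num), w0 1 (by norm_num)]

theorem eq_zero_of_form_E7 {v : Fin 7 → ℂ}
    (h : ∀ i : Fin 7, ∑ j : Fin 7, qnum ħ (SimpleType.E7.form i j * t) * v j = 0) : v = 0 := by
  have hy := isGeneric_qpow hq ht
  have row (i : Fin 7) := mul_eq_sum_neighbours hq ht (M := CartanMatrix.E₇.transpose)
    (by decide +revert) (by fin_cases i <;> decide) (h i)
  have hu : IsLegChain (qpow ħ t) 2 fun n => [0, v 1, v 3].getD n 0 :=
    ⟨rfl, fun n hn => by
      obtain rfl : n = 0 := (by omega)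
      simpa [Fin.sum_univ_succ, CartanMatrix.E₇] using row 1⟩
  have hv : IsLegChain (qpow ħ t) 3 fun n => [0, v 0, v 2, v 3].getD n 0 :=
    ⟨rfl, fun n hn => by
      obtain rfl | rfl : n = 0 ∨ n = 1 := (by omega)
      · simpa [Fin.sum_univ_succ, CartanMatrix.E₇] using row 0
      · simpa [Fin.sum_univ_succ, CartanMatrix.E₇] using row 2⟩
  have hw : IsLegChain (qpow ħ t) 4 fun n => [0, v 6, v 5, v 4, v 3].getD n 0 :=
    ⟨rfl, fun n hn => by
      obtain rfl | rfl | rfl : n = 0 ∨ n = 1 ∨ n = 2 := (by omega)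
      · simpa [Fin.sum_univ_succ, CartanMatrix.E₇, add_comm] using row 6
      · simpa [Fin.sum_univ_succ, CartanMatrix.E₇, add_comm] using row 5
      · simpa [Fin.sum_univ_succ, CartanMatrix.E₇, add_comm] using row 4⟩
  have hc : (qpow ħ t + (qpow ħ t)⁻¹) * v 3 = v 1 + v 2 + v 4 := by
    simpa [Fin.sum_univ_succ, CartanMatrix.E₇, add_assoc] using row 3
  obtain ⟨u0, v0, w0⟩ := star_eq_zero hy two_pos three_pos (by norm_num) hu hv hw rfl rfl hc
    (starDet_two_three_four_ne_zero hy)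
  ext i
  fin_cases i
  exacts [v0 1 (by norm_num), u0 1 (by norm_num), v0 2 (by norm_num), v0 3 le_rfl,
    w0 3 (by norm_num), w0 2 (by norm_num), w0 1 (by norm_num)]

theorem eq_zero_of_form_E8 {v : Fin 8 → ℂ}
    (h : ∀ i : Fin 8, ∑ j : Fin 8, qnum ħ (SimpleType.E8.form i j * t) * v j = 0) : v = 0 := by
  have hy := isGeneric_qpow hq ht
  have row (i : Fin 8) := mul_eq_sum_neighbours hq ht (M := CartanMatrix.E₈.transpose)
    (by decide +revert) (by fin_cases i <;> decide) (h i)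
  have hu : IsLegChain (qpow ħ t) 2 fun n => [0, v 1, v 3].getD n 0 :=
    ⟨rfl, fun n hn => by
      obtain rfl : n = 0 := (by omega)
      simpa [Fin.sum_univ_succ, CartanMatrix.E₈] using row 1⟩
  have hv : IsLegChain (qpow ħ t) 3 fun n => [0, v 0, v 2, v 3].getD n 0 :=
    ⟨rfl, fun n hn => by
      obtain rfl | rfl : n = 0 ∨ n = 1 := (by omega)
      · simpa [Fin.sum_univ_succ, CartanMatrix.E₈] using row 0
      · simpa [Fin.sum_univ_succ, CartanMatrix.E₈] using row 2⟩
  have hw : IsLegChain (qpow ħ t) 5 fun n => [0, v 7, v 6, v 5, v 4, v 3].getD n 0 :=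
    ⟨rfl, fun n hn => by
      obtain rfl | rfl | rfl | rfl : n = 0 ∨ n = 1 ∨ n = 2 ∨ n = 3 := (by omega)
      · simpa [Fin.sum_univ_succ, CartanMatrix.E₈, add_comm] using row 7
      · simpa [Fin.sum_univ_succ, CartanMatrix.E₈, add_comm] using row 6
      · simpa [Fin.sum_univ_succ, CartanMatrix.E₈, add_comm] using row 5
      · simpa [Fin.sum_univ_succ, CartanMatrix.E₈, add_comm] using row 4⟩
  have hc : (qpow ħ t + (qpow ħ t)⁻¹) * v 3 = v 1 + v 2 + v 4 := by
    simpa [Fin.sum_univ_succ, CartanMatrix.E₈, add_assoc] using row 3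
  obtain ⟨u0, v0, w0⟩ := star_eq_zero hy two_pos three_pos (by norm_num) hu hv hw rfl rfl hc
    (starDet_two_three_five_ne_zero hy)
  ext i
  fin_cases i
  exacts [v0 1 (by norm_num), u0 1 (by norm_num), v0 2 (by norm_num), v0 3 le_rfl,
    w0 4 (by norm_num), w0 3 (by norm_num), w0 2 (by norm_num), w0 1 (by norm_num)]

theorem eq_zero_of_form_F4 {v : Fin 4 → ℂ}
    (h : ∀ i : Fin 4, ∑ j : Fin 4, qnum ħ (SimpleType.F4.form i j * t) * v j = 0) : v = 0 := by
  obtain ⟨u, rfl⟩ : ∃ u, t = 2 * u := ⟨t / 2, by ring⟩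
  have hu : u ≠ 0 := right_ne_zero_of_mul ht
  have hy := isGeneric_qpow hq hu
  have hy2 : qpow ħ (2 * u) = qpow ħ u ^ 2 := mod_cast qpow_nat_mul ħ 2 u
  have row (i : Fin 4) := h i
  simp only [SimpleType.form, SimpleType.cartan, SimpleType.dd, CartanMatrix.F₄,
    Fin.sum_univ_four] at row
  set y := qpow ħ u
  have r0 : (y ^ 2 + (y ^ 2)⁻¹) * v 0 = v 1 := mul_left_cancel₀ (qnum_ne_zero hq ht) <| by
    linear_combination (by simpa [qnum_neg, qnum_two_mul _ (2 * u), hy2] using row 0 :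
      (y ^ 2 + (y ^ 2)⁻¹) * qnum ħ (2 * u) * v 0 + -(qnum ħ (2 * u) * v 1) = 0)
  have r1 : (y ^ 2 + (y ^ 2)⁻¹) * v 1 = v 0 + v 2 := mul_left_cancel₀ (qnum_ne_zero hq ht) <| by
    linear_combination (by simpa [qnum_neg, qnum_two_mul _ (2 * u), hy2] using row 1 :
      -(qnum ħ (2 * u) * v 0) + (y ^ 2 + (y ^ 2)⁻¹) * qnum ħ (2 * u) * v 1 +
        -(qnum ħ (2 * u) * v 2) = 0)
  have r2 : (y + y⁻¹) * v 2 = (y + y⁻¹) * v 1 + v 3 := mul_left_cancel₀ (qnum_ne_zero hq hu) <| by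
    linear_combination (by simpa [qnum_neg, qnum_two_mul] using row 2 :
      -((y + y⁻¹) * qnum ħ u * v 1) + (y + y⁻¹) * qnum ħ u * v 2 + -(qnum ħ u * v 3) = 0)
  have r3 : (y + y⁻¹) * v 3 = v 2 := mul_left_cancel₀ (qnum_ne_zero hq hu) <| by
    linear_combination (by simpa [qnum_neg, qnum_two_mul] using row 3 :
      -(qnum ħ u * v 2) + (y + y⁻¹) * qnum ħ u * v 3 = 0)
  exact eq_zero_of_F4_relations hy r0 r1 r2 r3

theorem eq_zero_of_form_G2 {v : Fin 2 → ℂ}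
    (h : ∀ i : Fin 2, ∑ j : Fin 2, qnum ħ (SimpleType.G2.form i j * t) * v j = 0) : v = 0 := by
  obtain ⟨u, rfl⟩ : ∃ u, t = 3 * u := ⟨t / 3, by ring⟩
  have hu : u ≠ 0 := right_ne_zero_of_mul ht
  have hy := isGeneric_qpow hq hu
  have hy0 := hy.ne_zero
  have hy3 : qpow ħ (3 * u) = qpow ħ u ^ 3 := mod_cast qpow_nat_mul ħ 3 u
  have short : 3⁻¹ * 2 * (3 * u) = 2 * u := by ring
  have row (i : Fin 2) := h i
  simp only [SimpleType.form, SimpleType.cartan, SimpleType.dd, CartanMatrix.G₂,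
    Fin.sum_univ_two] at row
  set y := qpow ħ u
  have r0 : (y ^ 3 + (y ^ 3)⁻¹) * v 0 = v 1 := mul_left_cancel₀ (qnum_ne_zero hq ht) <| by
    linear_combination (by simpa [qnum_neg, qnum_two_mul _ (3 * u), hy3] using row 0 :
      (y ^ 3 + (y ^ 3)⁻¹) * qnum ħ (3 * u) * v 0 + -(qnum ħ (3 * u) * v 1) = 0)
  have r1 : (y ^ 2 + 1 + (y ^ 2)⁻¹) * v 0 = (y + y⁻¹) * v 1 :=
    mul_left_cancel₀ (qnum_ne_zero hq hu) <| by
      linear_combination -(by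
        simpa [qnum_neg, short, qnum_two_mul, qnum_three_mul] using row 1 :
        -((y ^ 2 + 1 + (y ^ 2)⁻¹) * qnum ħ u * v 0) + (y + y⁻¹) * qnum ħ u * v 1 = 0)
  have hdet : (y ^ 8 - y ^ 4 + 1) * v 0 = 0 := by
    rw [← r0] at r1
    field_simp at r1
    linear_combination -r1
  have v0 : v 0 = 0 := (mul_eq_zero.1 hdet).resolve_left fun hz =>
    hy.pow_ne_neg_one (n := 12) (by norm_num) (by linear_combination (y ^ 4 + 1) * hz)
  have v1 : v 1 = 0 := by rw [← r0, v0, mul_zero]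
  ext i
  fin_cases i <;> assumption

theorem eq_zero_of_form (X : SimpleType) {v : X.Idx → ℂ}
    (h : ∀ i, ∑ j, qnum ħ (X.form i j * t) * v j = 0) : v = 0 := by
  cases X with
  | A l hl => exact eq_zero_of_form_A hq ht hl h
  | B l hl => exact eq_zero_of_form_B hq ht hl h
  | C l hl => exact eq_zero_of_form_C hq ht hl h
  | D l hl => exact eq_zero_of_form_D hq ht hl h
  | E6 => exact eq_zero_of_form_E6 hq ht h
  | E7 => exact eq_zero_of_form_E7 hq ht h
  | E8 => exact eq_zero_of_form_E8 hq ht h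
  | F4 => exact eq_zero_of_form_F4 hq ht h
  | G2 => exact eq_zero_of_form_G2 hq ht h

end Nondegenerate

/-! ### Fock representations -/

section TensorCoeffs

variable {P R M : Type*} [CommSemiring R] [AddCommMonoid M] [Module R M]

open scoped Classical in
/-- The coefficients in `M` of a polynomial with values in `M`, written as an element of
`MvPolynomial P R ⊗ M`. -/
def tensorCoeffs : MvPolynomial P R ⊗[R] M ≃ₗ[R] (P →₀ ℕ) →₀ M :=
  TensorProduct.equivFinsuppOfBasisLeft (MvPolynomial.basisMonomials P R)

theorem tensorCoeffs_tmul (u : MvPolynomial P R) (w : M) (s : P →₀ ℕ) :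
    tensorCoeffs (u ⊗ₜ[R] w) s = MvPolynomial.coeff s u • w := by
  classical exact TensorProduct.equivFinsuppOfBasisLeft_apply_tmul_apply _ u w s

theorem tensorCoeffs_rTensor_pderiv (p : P) (t : MvPolynomial P R ⊗[R] M) (s : P →₀ ℕ) :
    tensorCoeffs ((MvPolynomial.pderiv p).toLinearMap.rTensor M t) s =
      ((s p : R) + 1) • tensorCoeffs t (s + Finsupp.single p 1) := by
  induction t with
  | zero => simp only [map_zero, Finsupp.zero_apply, smul_zero]
  | add t t' h h' => simp only [map_add, Finsupp.add_apply, smul_add, h, h']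
  | tmul u w =>
    rw [LinearMap.rTensor_tmul, tensorCoeffs_tmul, tensorCoeffs_tmul, Derivation.coeFn_coe,
      MvPolynomial.coeff_pderiv, smul_smul, mul_comm]

theorem eq_one_tmul_of_tensorCoeffs_eq_zero {t : MvPolynomial P R ⊗[R] M}
    (h : ∀ s ≠ 0, tensorCoeffs t s = 0) : t = 1 ⊗ₜ tensorCoeffs t 0 := by
  classical
  refine tensorCoeffs.injective (Finsupp.ext fun s => ?_)
  rw [tensorCoeffs_tmul, MvPolynomial.coeff_one]
  split_ifs with hs
  · rw [← hs, one_smul]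
  · rw [h s (Ne.symm hs), zero_smul]

theorem eq_zero_of_tensorCoeffs_eq_zero {t : MvPolynomial P R ⊗[R] M}
    (h : ∀ s, tensorCoeffs t s = 0) : t = 0 :=
  (LinearEquiv.map_eq_zero_iff tensorCoeffs).1 (Finsupp.ext h)

end TensorCoeffs

theorem eq_one_tmul_of_pderiv_eq_zero {P K M : Type*} [Field K] [CharZero K] [AddCommGroup M]
    [Module K M] {t : MvPolynomial P K ⊗[K] M}
    (h : ∀ p, (MvPolynomial.pderiv p).toLinearMap.rTensor M t = 0) :
    t = 1 ⊗ₜ tensorCoeffs t 0 := by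
  refine eq_one_tmul_of_tensorCoeffs_eq_zero fun s hs => ?_
  obtain ⟨p, hp⟩ := Finsupp.ne_iff.1 hs
  have hps : Finsupp.single p 1 ≤ s := Finsupp.single_le_iff.2 (Nat.one_le_iff_ne_zero.2 hp)
  have hcoeff := tensorCoeffs_rTensor_pderiv p t (s - Finsupp.single p 1)
  rw [h p, map_zero, Finsupp.zero_apply, tsub_add_cancel_of_le hps, eq_comm, smul_eq_zero] at hcoeff
  exact hcoeff.resolve_left (Nat.cast_add_one_ne_zero _)

theorem lie_algHom {P R S : Type*} [CommRing R] [Ring S] [Algebra R S]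
    (φ : MvPolynomial P R →ₐ[R] S) {a : S} {s : P → R}
    (h : ∀ p, ⁅a, φ (MvPolynomial.X p)⁆ = s p • (1 : S)) (u : MvPolynomial P R) :
    ⁅a, φ u⁆ = φ (MvPolynomial.mkDerivation R
      (fun p => (MvPolynomial.C (s p) : MvPolynomial P R)) u) := by
  induction u using MvPolynomial.induction_on with
  | C c =>
    rw [← MvPolynomial.algebraMap_eq, Derivation.map_algebraMap, map_zero, AlgHom.commutes]
    exact (Algebra.commute_algebraMap_right c a).lie_eq
  | add u v hu hv => rw [map_add, lie_add, hu, hv, map_add, map_add]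
  | mul_X u p hu =>
    rw [Derivation.leibniz, MvPolynomial.mkDerivation_X, map_mul, lie_mul_eq, hu, h, smul_eq_mul,
      smul_eq_mul, map_add, map_mul, map_mul, mul_smul_one, ← MvPolynomial.algebraMap_eq,
      AlgHom.commutes, Algebra.algebraMap_eq_smul_one, mul_smul_one, ← map_mul,
      mul_comm (_ : MvPolynomial P R), add_comm, map_mul]

section FockMap

variable {P R V : Type*} [CommRing R] [AddCommGroup V] [Module R V]
  (φ : MvPolynomial P R →ₐ[R] Module.End R V) (Ω : Submodule R V)

/-- The map `u ⊗ w ↦ φ(u) w`, comparing `V` with a multiple of the polynomial representation. -/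
def fockMap : MvPolynomial P R ⊗[R] Ω →ₗ[R] V :=
  TensorProduct.lift (LinearMap.lcomp R V Ω.subtype ∘ₗ φ.toLinearMap)

@[simp]
theorem fockMap_tmul (u : MvPolynomial P R) (w : Ω) : fockMap φ Ω (u ⊗ₜ[R] w) = φ u (w : V) := rfl

variable {φ Ω}

theorem apply_mem_range_fockMap (u : MvPolynomial P R) {v : V}
    (hv : v ∈ LinearMap.range (fockMap φ Ω)) : φ u v ∈ LinearMap.range (fockMap φ Ω) := by
  obtain ⟨t, rfl⟩ := hv
  refine ⟨(LinearMap.mulLeft R u).rTensor Ω t, ?_⟩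
  induction t with
  | zero => simp only [map_zero]
  | add t t' h h' => simp only [map_add, h, h']
  | tmul u' w =>
    rw [LinearMap.rTensor_tmul, fockMap_tmul, fockMap_tmul, LinearMap.mulLeft_apply, map_mul,
      Module.End.mul_apply]

theorem apply_algHom_of_apply_eq_zero {a : Module.End R V} {s : P → R}
    (h : ∀ p, ⁅a, φ (MvPolynomial.X p)⁆ = s p • (1 : Module.End R V)) {w : V} (hw : a w = 0)
    (u : MvPolynomial P R) :
    a (φ u w) = φ (MvPolynomial.mkDerivation R
      (fun p => (MvPolynomial.C (s p) : MvPolynomial P R)) u) w := by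
  rw [← lie_algHom φ h u, Ring.lie_def, LinearMap.sub_apply, Module.End.mul_apply,
    Module.End.mul_apply, hw, map_zero, sub_zero]

theorem pow_apply_pow_apply_of_lie_eq_one {a b : Module.End R V} (h : ⁅a, b⁆ = 1) {u : V}
    (hu : a u = 0) (N : ℕ) : (a ^ N) ((b ^ N) u) = (N.factorial : R) • u := by
  induction N with
  | zero => simp
  | succ N ih =>
    have step : a ((b ^ (N + 1)) u) = ((N + 1 : ℕ) : R) • (b ^ N) u := by
      have hlie := lie_pow_succ_of_commute (h ▸ Commute.one_left b) N
      rw [h, one_mul, Ring.lie_def, sub_eq_iff_eq_add] at hlie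
      rw [← Module.End.mul_apply, hlie, LinearMap.add_apply, Module.End.mul_apply, hu, map_zero,
        add_zero, LinearMap.smul_apply, Nat.cast_smul_eq_nsmul]
    rw [pow_succ a N, Module.End.mul_apply, step, map_smul, ih, smul_smul,
      Nat.factorial_succ, Nat.cast_mul]

variable [DecidableEq P] {D : P → Module.End R V}
  (hD : ∀ p r, ⁅D p, φ (MvPolynomial.X r)⁆ = if p = r then 1 else 0)
include hD

theorem apply_fockMap_eq_fockMap_pderiv (hΩ : ∀ w ∈ Ω, ∀ p, D p w = 0) (p : P)
    (t : MvPolynomial P R ⊗[R] Ω) :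
    D p (fockMap φ Ω t) = fockMap φ Ω ((MvPolynomial.pderiv p).toLinearMap.rTensor Ω t) := by
  have lie_X (r : P) : ⁅D p, φ (MvPolynomial.X r)⁆ =
      (Pi.single p 1 : P → R) r • (1 : Module.End R V) := by
    rw [hD, Pi.single_apply, ite_smul, one_smul, zero_smul]
    simp only [eq_comm]
  have pderiv_eq : MvPolynomial.mkDerivation R
      (fun r => (MvPolynomial.C ((Pi.single p 1 : P → R) r) : MvPolynomial P R)) =
        MvPolynomial.pderiv p := by
    refine MvPolynomial.derivation_ext fun r => ?_
    rw [MvPolynomial.mkDerivation_X, MvPolynomial.pderiv_X, Pi.single_apply, Pi.single_apply]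
    split_ifs <;> simp
  induction t with
  | zero => simp only [map_zero]
  | add t t' h h' => simp only [map_add, h, h']
  | tmul u w =>
    rw [fockMap_tmul, apply_algHom_of_apply_eq_zero lie_X (hΩ w w.2 p) u, pderiv_eq,
      LinearMap.rTensor_tmul, fockMap_tmul, Derivation.coeFn_coe]

end FockMap

section Bijective

variable {P K V : Type*} [DecidableEq P] [Field K] [CharZero K] [AddCommGroup V] [Module K V]
  {φ : MvPolynomial P K →ₐ[K] Module.End K V} {Ω : Submodule K V} {D : P → Module.End K V}

theorem fockMap_injective
    (hD : ∀ p r, ⁅D p, φ (MvPolynomial.X r)⁆ = if p = r then 1 else 0)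
    (hΩ : ∀ w ∈ Ω, ∀ p, D p w = 0) : Function.Injective (fockMap φ Ω) := by
  suffices H : ∀ (n : ℕ) (t : MvPolynomial P K ⊗[K] Ω), fockMap φ Ω t = 0 →
      (∀ s, n ≤ s.degree → tensorCoeffs t s = 0) → t = 0 by
    refine (injective_iff_map_eq_zero _).2 fun t ht =>
      H ((tensorCoeffs t).support.sup Finsupp.degree + 1) t ht fun s hs => ?_
    by_contra hne
    exact (Finset.le_sup (f := Finsupp.degree) (Finsupp.mem_support_iff.2 hne)).not_gt hs
  intro n
  induction n with
  | zero => exact fun t _ h => eq_zero_of_tensorCoeffs_eq_zero fun s => h s (Nat.zero_le _)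
  | succ n ih =>
    intro t ht h
    have pderiv_eq_zero (p : P) : (MvPolynomial.pderiv p).toLinearMap.rTensor Ω t = 0 := by
      refine ih _ (by rw [← apply_fockMap_eq_fockMap_pderiv hD hΩ, ht, map_zero]) fun s hs => ?_
      rw [tensorCoeffs_rTensor_pderiv, h _ (by rwa [map_add, Finsupp.degree_single,
        Nat.succ_le_succ_iff]), smul_zero]
    have ht1 := eq_one_tmul_of_pderiv_eq_zero pderiv_eq_zero
    rw [ht1, fockMap_tmul, map_one, Module.End.one_apply, Submodule.coe_eq_zero] at ht
    rw [ht1, ht, TensorProduct.tmul_zero]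

/-- Taylor's formula: subtracting `b ^ N (a ^ N v) / N!` lowers the order of nilpotency of `a`. -/
theorem mem_of_pow_apply_eq_zero {a b : Module.End K V} (h : ⁅a, b⁆ = 1) {U W : Submodule K V}
    (haU : ∀ u ∈ U, a u ∈ U) (hbU : ∀ u ∈ U, b u ∈ U) (hbW : ∀ u ∈ W, b u ∈ W)
    (hker : ∀ u ∈ U, a u = 0 → u ∈ W) (N : ℕ) {v : V} (hv : v ∈ U) (hN : (a ^ N) v = 0) :
    v ∈ W := by
  induction N generalizing v with
  | zero => rw [show v = 0 from hN]; exact zero_mem W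
  | succ N ih =>
    set u := (a ^ N) v with hu
    have hau : a u = 0 := by rwa [hu, ← Module.End.mul_apply, ← pow_succ']
    have huU : u ∈ U := Module.End.pow_apply_mem_of_forall_mem N haU v hv
    have hbuU : (b ^ N) u ∈ U := Module.End.pow_apply_mem_of_forall_mem N hbU u huU
    have hbuW : (b ^ N) u ∈ W :=
      Module.End.pow_apply_mem_of_forall_mem N hbW u (hker u huU hau)
    have hsub : v - (N.factorial : K)⁻¹ • (b ^ N) u ∈ W := by
      refine ih (sub_mem hv (U.smul_mem _ hbuU)) ?_
      rw [map_sub, map_smul, pow_apply_pow_apply_of_lie_eq_one h hau,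
        inv_smul_smul₀ (mod_cast N.factorial_ne_zero), sub_self]
    simpa only [sub_add_cancel] using add_mem hsub (W.smul_mem (N.factorial : K)⁻¹ hbuW)

theorem fockMap_surjective
    (hD : ∀ p r, ⁅D p, φ (MvPolynomial.X r)⁆ = if p = r then 1 else 0)
    (hΩ : ∀ w, (∀ p, D p w = 0) → w ∈ Ω)
    (hDD : ∀ p r, Commute (D p) (D r)) (hnil : ∀ p v, ∃ N : ℕ, (D p ^ N) v = 0)
    (hfin : ∀ v, {p | D p v ≠ 0}.Finite) :
    Function.Surjective (fockMap φ Ω) := by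
  suffices H : ∀ (S : Finset P) (v : V), (∀ p ∉ S, D p v = 0) →
      v ∈ LinearMap.range (fockMap φ Ω) from
    fun v => H (hfin v).toFinset v fun p hp => by simpa using hp
  intro S
  induction S using Finset.induction_on with
  | empty => exact fun v hv => ⟨1 ⊗ₜ ⟨v, hΩ v fun p => hv p (Finset.notMem_empty p)⟩, by simp⟩
  | insert p S _ ih =>
    intro v hv
    obtain ⟨N, hN⟩ := hnil p v
    let U : Submodule K V := ⨅ r ∉ insert p S, LinearMap.ker (D r)
    have mem_U (w : V) : w ∈ U ↔ ∀ r ∉ insert p S, D r w = 0 := by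
      simp only [U, Submodule.mem_iInf, LinearMap.mem_ker]
    have stable {f : Module.End K V} (hf : ∀ r ∉ insert p S, Commute (D r) f) (u : V)
        (hu : u ∈ U) : f u ∈ U := (mem_U _).2 fun r hr => by
      rw [← Module.End.mul_apply, (hf r hr).eq, Module.End.mul_apply, (mem_U u).1 hu r hr,
        map_zero]
    refine mem_of_pow_apply_eq_zero (by rw [hD, if_pos rfl]) (stable fun r _ => hDD r p)
      (stable fun r hr => commute_of_lie_eq_zero ?_) (fun u => apply_mem_range_fockMap _)
      (fun u hu hpu => ih u fun r hr => ?_) N ((mem_U v).2 hv) hN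
    · rw [hD, if_neg fun hrp : r = p => hr (hrp ▸ Finset.mem_insert_self p S)]
    · by_cases hrp : r = p
      · rw [hrp, hpu]
      · exact (mem_U u).1 hu r (by simp [hrp, hr])

end Bijective

/-! ### Dressing a field by power series -/

section Dressing

variable {R V : Type*} [CommRing R] [AddCommGroup V] [Module R V]

variable (R V) in
/-- A field on `V`: a formal distribution `∑ m : ℤ, x m z ^ m` of operators such that, applied to a
vector, it has only finitely many terms with `m < 0`. -/
@[ext]
structure FormalField where
  /-- The coefficient of `z ^ m`. -/
  mode : ℤ → Module.End R V
  exists_forall_lt_apply_eq_zero : ∀ v, ∃ M : ℤ, ∀ m < M, mode m v = 0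

/-- Every vector is annihilated by all but finitely many coefficients of `B`, so that `B(z⁻¹)`
maps vectors to polynomials in `z⁻¹`. -/
def VectorwiseFinite (B : PowerSeries (Module.End R V)) : Prop :=
  ∀ v, ∃ N, ∀ n ≥ N, coeff n B v = 0

theorem VectorwiseFinite.exists_forall_coeff_apply_coeff_apply_eq_zero
    {B B' : PowerSeries (Module.End R V)} (hB : VectorwiseFinite B) (hB' : VectorwiseFinite B')
    (v : V) : ∃ N, ∀ r s, N ≤ r + s → coeff r B (coeff s B' v) = 0 := by
  obtain ⟨N', hN'⟩ := hB' v
  choose N hN using hB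
  refine ⟨(Finset.range N').sup (fun s => N (coeff s B' v)) + N', fun r s hrs => ?_⟩
  rcases lt_or_ge s N' with hs | hs
  · have hle := Finset.le_sup (f := fun s => N (coeff s B' v)) (Finset.mem_range.2 hs)
    exact hN _ _ (by omega)
  · rw [hN' s hs, map_zero]

theorem VectorwiseFinite.mul {B B' : PowerSeries (Module.End R V)} (hB : VectorwiseFinite B)
    (hB' : VectorwiseFinite B') : VectorwiseFinite (B * B') := by
  intro v
  obtain ⟨N, hN⟩ := hB.exists_forall_coeff_apply_coeff_apply_eq_zero hB' v
  refine ⟨N, fun n hn => ?_⟩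
  rw [PowerSeries.coeff_mul, LinearMap.sum_apply]
  refine Finset.sum_eq_zero fun rs hrs => hN _ _ ?_
  rwa [Finset.HasAntidiagonal.mem_antidiagonal.1 hrs]

namespace FormalField

variable (A A' : PowerSeries (Module.End R V)) {B B' : PowerSeries (Module.End R V)}
  (x : FormalField R V)

theorem exists_forall_mode_sub_apply_eq_zero (m : ℤ) (v : V) :
    ∃ N : ℕ, ∀ p ≥ N, x.mode (m - p) v = 0 := by
  obtain ⟨M, hM⟩ := x.exists_forall_lt_apply_eq_zero v
  exact ⟨(m - M).toNat + 1, fun p hp => hM _ (by omega)⟩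

theorem exists_forall_mode_add_apply_coeff_eq_zero (hB : VectorwiseFinite B) (v : V) :
    ∃ M : ℤ, ∀ m < M, ∀ r : ℕ, x.mode (m + r) (coeff r B v) = 0 := by
  obtain ⟨N, hN⟩ := hB v
  choose M hM using x.exists_forall_lt_apply_eq_zero
  obtain ⟨M₀, hM₀⟩ := ((Finset.range N).image fun r => M (coeff r B v)).bddBelow
  refine ⟨M₀ - N, fun m hm r => ?_⟩
  rcases lt_or_ge r N with hr | hr
  · have hle := hM₀ (Finset.mem_coe.2 (Finset.mem_image_of_mem _ (Finset.mem_range.2 hr)))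
    exact hM _ _ (by omega)
  · rw [hN r hr, map_zero]

theorem exists_forall_mode_sub_add_apply_coeff_eq_zero (hB : VectorwiseFinite B) (m : ℤ) (v : V) :
    ∃ N : ℕ, ∀ p ≥ N, ∀ r : ℕ, x.mode (m - p + r) (coeff r B v) = 0 := by
  obtain ⟨M, hM⟩ := x.exists_forall_mode_add_apply_coeff_eq_zero hB v
  exact ⟨(m - M).toNat + 1, fun p hp => hM _ (by omega)⟩

theorem finite_support_lmul (m : ℤ) (v : V) :
    (Function.support fun p : ℕ => coeff p A (x.mode (m - p) v)).Finite := by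
  obtain ⟨N, hN⟩ := x.exists_forall_mode_sub_apply_eq_zero m v
  refine (Set.finite_Iio N).subset fun p hp => ?_
  contrapose! hp
  simp [hN p (by simpa using hp)]

theorem finite_support_rmul (hB : VectorwiseFinite B) (m : ℤ) (v : V) :
    (Function.support fun r : ℕ => x.mode (m + r) (coeff r B v)).Finite := by
  obtain ⟨N, hN⟩ := hB v
  refine (Set.finite_Iio N).subset fun r hr => ?_
  contrapose! hr
  simp [hN r (by simpa using hr)]

/-- The field `A(z) x(z)`. -/
def lmul : FormalField R V where
  mode m :=
    { toFun v := ∑ᶠ p : ℕ, coeff p A (x.mode (m - p) v)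
      map_add' v w := by
        simp only [map_add]
        exact finsum_add_distrib (x.finite_support_lmul A m v) (x.finite_support_lmul A m w)
      map_smul' c v := by
        simp only [map_smul, RingHom.id_apply]
        exact (smul_finsum' c (x.finite_support_lmul A m v)).symm }
  exists_forall_lt_apply_eq_zero v := by
    obtain ⟨M, hM⟩ := x.exists_forall_lt_apply_eq_zero v
    refine ⟨M, fun m hm => finsum_eq_zero_of_forall_eq_zero fun p => ?_⟩
    rw [hM _ (by omega), map_zero]

/-- The field `x(z) B(z⁻¹)`. -/
def rmul (hB : VectorwiseFinite B) : FormalField R V where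
  mode m :=
    { toFun v := ∑ᶠ r : ℕ, x.mode (m + r) (coeff r B v)
      map_add' v w := by
        simp only [map_add]
        exact finsum_add_distrib (x.finite_support_rmul hB m v) (x.finite_support_rmul hB m w)
      map_smul' c v := by
        simp only [map_smul, RingHom.id_apply]
        exact (smul_finsum' c (x.finite_support_rmul hB m v)).symm }
  exists_forall_lt_apply_eq_zero v := by
    obtain ⟨M, hM⟩ := x.exists_forall_mode_add_apply_coeff_eq_zero hB v
    exact ⟨M, fun m hm => finsum_eq_zero_of_forall_eq_zero (hM m hm)⟩

variable {x} in
theorem lmul_apply_eq_sum {m : ℤ} {v : V} {N : ℕ} (h : ∀ p ≥ N, x.mode (m - p) v = 0) :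
    (x.lmul A).mode m v = ∑ p ∈ Finset.range N, coeff p A (x.mode (m - p) v) := by
  refine finsum_eq_sum_of_support_subset _ fun p hp => ?_
  contrapose! hp
  simp [h p (by simpa using hp)]

variable {x} in
theorem rmul_apply_eq_sum (hB : VectorwiseFinite B) {m : ℤ} {v : V} {N : ℕ}
    (h : ∀ r ≥ N, x.mode (m + r) (coeff r B v) = 0) :
    (x.rmul hB).mode m v = ∑ r ∈ Finset.range N, x.mode (m + r) (coeff r B v) := by
  refine finsum_eq_sum_of_support_subset _ fun r hr => ?_
  contrapose! hr
  simp [h r (by simpa using hr)]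

theorem lmul_one : x.lmul 1 = x := by
  ext m v
  refine (finsum_eq_single _ 0 fun p hp => ?_).trans ?_
  · simp [PowerSeries.coeff_one, hp]
  · simp

theorem rmul_of_eq_one (hB : VectorwiseFinite B) (h : B = 1) : x.rmul hB = x := by
  subst h
  ext m v
  refine (finsum_eq_single _ 0 fun p hp => ?_).trans ?_
  · simp [PowerSeries.coeff_one, hp]
  · simp

theorem lmul_lmul : (x.lmul A).lmul A' = x.lmul (A' * A) := by
  ext m v
  obtain ⟨N, hN⟩ := x.exists_forall_mode_sub_apply_eq_zero m v
  have inner (p : ℕ) : (x.lmul A).mode (m - p) v =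
      ∑ q ∈ Finset.range (N - p), coeff q A (x.mode (m - (p + q : ℕ)) v) := by
    have hNp (q : ℕ) (hq : q ≥ N - p) : x.mode (m - p - q) v = 0 := by
      simpa [sub_sub] using hN (p + q) (by omega)
    simp only [lmul_apply_eq_sum A hNp, Nat.cast_add, sub_sub]
  rw [lmul_apply_eq_sum A' (N := N) fun p hp => by simp [inner, Nat.sub_eq_zero_of_le hp],
    lmul_apply_eq_sum _ hN]
  simp only [inner, map_sum, PowerSeries.coeff_mul, LinearMap.sum_apply, Module.End.mul_apply]
  rw [← Finset.sum_range_diag_flip N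
    fun p q => coeff p A' (coeff q A (x.mode (m - (p + q : ℕ)) v))]
  refine Finset.sum_congr rfl fun n _ => ?_
  rw [Finset.Nat.sum_antidiagonal_eq_sum_range_succ
    fun p q => coeff p A' (coeff q A (x.mode (m - n) v))]
  refine Finset.sum_congr rfl fun p hp => ?_
  rw [Nat.add_sub_cancel' (Finset.mem_range_succ_iff.1 hp)]

theorem rmul_rmul (hB : VectorwiseFinite B) (hB' : VectorwiseFinite B') :
    (x.rmul hB).rmul hB' = x.rmul (hB.mul hB') := by
  ext m v
  obtain ⟨N, hN⟩ := hB.exists_forall_coeff_apply_coeff_apply_eq_zero hB' v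
  have inner (s : ℕ) : (x.rmul hB).mode (m + s) (coeff s B' v) =
      ∑ r ∈ Finset.range (N - s), x.mode (m + (s + r : ℕ)) (coeff r B (coeff s B' v)) := by
    have hNs (r : ℕ) (hr : r ≥ N - s) : x.mode (m + s + r) (coeff r B (coeff s B' v)) = 0 := by
      rw [hN r s (by omega), map_zero]
    simp only [rmul_apply_eq_sum hB hNs, Nat.cast_add, add_assoc]
  have product (n : ℕ) : coeff n (B * B') v =
      ∑ s ∈ Finset.range (n + 1), coeff (n - s) B (coeff s B' v) := by
    rw [PowerSeries.coeff_mul, ← Finset.Nat.sum_antidiagonal_swap,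
      Finset.Nat.sum_antidiagonal_eq_sum_range_succ_mk, LinearMap.sum_apply]
    rfl
  have product_eq_zero (n : ℕ) (hn : n ≥ N) : coeff n (B * B') v = 0 := by
    rw [product]
    exact Finset.sum_eq_zero fun s hs => hN _ _ (by grind)
  rw [rmul_apply_eq_sum hB' (N := N) fun s hs => by simp [inner, Nat.sub_eq_zero_of_le hs],
    rmul_apply_eq_sum (hB.mul hB') fun n hn => by rw [product_eq_zero n hn, map_zero]]
  simp only [inner, product, map_sum]
  rw [← Finset.sum_range_diag_flip N
    fun s r => x.mode (m + (s + r : ℕ)) (coeff r B (coeff s B' v))]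
  refine Finset.sum_congr rfl fun n _ => Finset.sum_congr rfl fun s hs => ?_
  rw [Nat.add_sub_cancel' (Finset.mem_range_succ_iff.1 hs)]

theorem lmul_rmul_apply_eq_sum (hB : VectorwiseFinite B) {m : ℤ} {v : V} {N K : ℕ}
    (hN : ∀ p ≥ N, ∀ r : ℕ, x.mode (m - p + r) (coeff r B v) = 0)
    (hK : ∀ r ≥ K, coeff r B v = 0) :
    ((x.rmul hB).lmul A).mode m v =
      ∑ p ∈ Finset.range N, ∑ r ∈ Finset.range K,
        coeff p A (x.mode (m - p + r) (coeff r B v)) := by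
  rw [lmul_apply_eq_sum A fun p hp => finsum_eq_zero_of_forall_eq_zero (hN p hp)]
  refine Finset.sum_congr rfl fun p _ => ?_
  rw [rmul_apply_eq_sum hB fun r hr => by rw [hK r hr, map_zero], map_sum]

theorem rmul_lmul (hB : VectorwiseFinite B) : (x.lmul A).rmul hB = (x.rmul hB).lmul A := by
  ext m v
  obtain ⟨N, hN⟩ := x.exists_forall_mode_sub_add_apply_coeff_eq_zero hB m v
  obtain ⟨K, hK⟩ := hB v
  rw [x.lmul_rmul_apply_eq_sum A hB hN hK, Finset.sum_comm,
    rmul_apply_eq_sum hB fun r hr => by rw [hK r hr, map_zero]]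
  refine Finset.sum_congr rfl fun r _ => ?_
  rw [lmul_apply_eq_sum A fun p hp => by rw [add_sub_right_comm, hN p hp r]]
  simp only [add_sub_right_comm]

theorem finite_support_lmul_rmul (hB : VectorwiseFinite B) (m : ℤ) (v : V) :
    (Function.support fun pr : ℕ × ℕ =>
      coeff pr.1 A (x.mode (m - pr.1 + pr.2) (coeff pr.2 B v))).Finite := by
  obtain ⟨N, hN⟩ := x.exists_forall_mode_sub_add_apply_coeff_eq_zero hB m v
  obtain ⟨K, hK⟩ := hB v
  refine ((Set.finite_Iio N).prod (Set.finite_Iio K)).subset fun pr hpr => ⟨?_, ?_⟩ <;>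
    contrapose! hpr
  · simp [hN pr.1 (by simpa using hpr)]
  · simp [hK pr.2 (by simpa using hpr)]

theorem lmul_rmul_apply (hB : VectorwiseFinite B) (m : ℤ) (v : V) :
    ((x.rmul hB).lmul A).mode m v =
      ∑ᶠ pr : ℕ × ℕ, coeff pr.1 A (x.mode (m - pr.1 + pr.2) (coeff pr.2 B v)) := by
  obtain ⟨N, hN⟩ := x.exists_forall_mode_sub_add_apply_coeff_eq_zero hB m v
  obtain ⟨K, hK⟩ := hB v
  rw [x.lmul_rmul_apply_eq_sum A hB hN hK, ← Finset.sum_product',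
    finsum_eq_sum_of_support_subset]
  intro pr hpr
  rw [Finset.coe_product]
  refine ⟨?_, ?_⟩ <;> contrapose! hpr
  · simp [hN pr.1 (by simpa using hpr)]
  · simp [hK pr.2 (by simpa using hpr)]

variable {A A'} in
theorem lmul_rmul_lmul_rmul (hA : A' * A = 1) (hB : VectorwiseFinite B) (hB' : VectorwiseFinite B')
    (hBB' : B * B' = 1) : ((((x.rmul hB).lmul A).rmul hB').lmul A') = x := by
  rw [rmul_lmul, lmul_lmul, hA, lmul_one, rmul_rmul, rmul_of_eq_one _ _ hBB']

variable {A x} {a : Module.End R V} {n : ℕ} {c c' : R}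

theorem lie_lmul (hA : ∀ p, ⁅a, coeff p A⁆ = if n ≤ p then c • coeff (p - n) A else 0)
    (hx : ∀ m, ⁅a, x.mode m⁆ = c' • x.mode (m - n)) (m : ℤ) :
    ⁅a, (x.lmul A).mode m⁆ = (c + c') • (x.lmul A).mode (m - n) := by
  ext v
  obtain ⟨N₁, hN₁⟩ := x.exists_forall_mode_sub_apply_eq_zero m v
  obtain ⟨N₂, hN₂⟩ := x.exists_forall_mode_sub_apply_eq_zero m (a v)
  have hN (p : ℕ) (hp : p ≥ N₁) : x.mode (m - n - p) v = 0 := by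
    simpa [sub_sub] using hN₁ (n + p) (by omega)
  have leibniz (p : ℕ) : a (coeff p A (x.mode (m - p) v)) - coeff p A (x.mode (m - p) (a v)) =
      (if n ≤ p then c • coeff (p - n) A (x.mode (m - p) v) else 0) +
        c' • coeff p A (x.mode (m - n - p) v) := by
    have h := LinearMap.congr_fun (lie_mul_eq a (coeff p A) (x.mode (m - p))) v
    rw [hA, hx, sub_right_comm] at h
    split_ifs at h ⊢ <;> simpa [Ring.lie_def] using h
  calc ⁅a, (x.lmul A).mode m⁆ v
      = ∑ p ∈ Finset.range (n + (N₁ + N₂)),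
          (a (coeff p A (x.mode (m - p) v)) - coeff p A (x.mode (m - p) (a v))) := by
        rw [Ring.lie_def, LinearMap.sub_apply, Module.End.mul_apply, Module.End.mul_apply,
          lmul_apply_eq_sum A (N := n + (N₁ + N₂)) fun p hp => hN₁ p (by omega),
          lmul_apply_eq_sum A (N := n + (N₁ + N₂)) fun p hp => hN₂ p (by omega), map_sum,
          Finset.sum_sub_distrib]
    _ = ∑ p ∈ Finset.range (N₁ + N₂), c • coeff p A (x.mode (m - n - p) v) +
          ∑ p ∈ Finset.range (n + (N₁ + N₂)), c' • coeff p A (x.mode (m - n - p) v) := by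
        rw [Finset.sum_congr rfl fun p _ => leibniz p, Finset.sum_add_distrib,
          Finset.sum_range_add, Finset.sum_eq_zero fun p hp => if_neg (by simpa using hp), zero_add]
        simp [sub_sub]
    _ = ((c + c') • (x.lmul A).mode (m - n)) v := by
        rw [← Finset.smul_sum, ← Finset.smul_sum,
          ← lmul_apply_eq_sum A fun p hp => hN p (by omega),
          ← lmul_apply_eq_sum A fun p hp => hN p (by omega), ← add_smul, LinearMap.smul_apply]

theorem lie_rmul (hB : VectorwiseFinite B)
    (haB : ∀ r, ⁅a, coeff r B⁆ = if n ≤ r then c • coeff (r - n) B else 0)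
    (hx : ∀ m, ⁅a, x.mode m⁆ = c' • x.mode (m + n)) (m : ℤ) :
    ⁅a, (x.rmul hB).mode m⁆ = (c + c') • (x.rmul hB).mode (m + n) := by
  ext v
  obtain ⟨N₁, hN₁⟩ := hB v
  obtain ⟨N₂, hN₂⟩ := hB (a v)
  have leibniz (r : ℕ) : a (x.mode (m + r) (coeff r B v)) - x.mode (m + r) (coeff r B (a v)) =
      (if n ≤ r then c • x.mode (m + r) (coeff (r - n) B v) else 0) +
        c' • x.mode (m + n + r) (coeff r B v) := by
    have h := LinearMap.congr_fun (lie_mul_eq a (x.mode (m + r)) (coeff r B)) v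
    rw [haB, hx, add_right_comm, add_comm (_ • _ * _)] at h
    split_ifs at h ⊢ <;> simpa [Ring.lie_def] using h
  calc ⁅a, (x.rmul hB).mode m⁆ v
      = ∑ r ∈ Finset.range (n + (N₁ + N₂)),
          (a (x.mode (m + r) (coeff r B v)) - x.mode (m + r) (coeff r B (a v))) := by
        rw [Ring.lie_def, LinearMap.sub_apply, Module.End.mul_apply, Module.End.mul_apply,
          rmul_apply_eq_sum hB (N := n + (N₁ + N₂)) fun r hr => by
            rw [hN₁ r (by omega), map_zero],
          rmul_apply_eq_sum hB (N := n + (N₁ + N₂)) fun r hr => by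
            rw [hN₂ r (by omega), map_zero], map_sum,
          Finset.sum_sub_distrib]
    _ = ∑ r ∈ Finset.range (N₁ + N₂), c • x.mode (m + n + r) (coeff r B v) +
          ∑ r ∈ Finset.range (n + (N₁ + N₂)), c' • x.mode (m + n + r) (coeff r B v) := by
        rw [Finset.sum_congr rfl fun r _ => leibniz r, Finset.sum_add_distrib,
          Finset.sum_range_add, Finset.sum_eq_zero fun r hr => if_neg (by simpa using hr), zero_add]
        simp [add_assoc]
    _ = ((c + c') • (x.rmul hB).mode (m + n)) v := by
        rw [← Finset.smul_sum, ← Finset.smul_sum,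
          ← rmul_apply_eq_sum hB fun r hr => by rw [hN₁ r (by omega), map_zero],
          ← rmul_apply_eq_sum hB fun r hr => by rw [hN₁ r (by omega), map_zero], ← add_smul,
          LinearMap.smul_apply]

theorem commute_lmul (hA : ∀ p, Commute a (coeff p A)) (hx : ∀ m, Commute a (x.mode m)) (m : ℤ) :
    Commute a ((x.lmul A).mode m) := by
  refine commute_of_lie_eq_zero ?_
  rw [lie_lmul (n := 0) (c := 0) (c' := 0) (fun p => by simp [(hA p).lie_eq])
    (fun m => by simp [(hx m).lie_eq]), add_zero, zero_smul]

theorem commute_rmul (hB : VectorwiseFinite B) (haB : ∀ r, Commute a (coeff r B))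
    (hx : ∀ m, Commute a (x.mode m)) (m : ℤ) : Commute a ((x.rmul hB).mode m) := by
  refine commute_of_lie_eq_zero ?_
  rw [lie_rmul hB (n := 0) (c := 0) (c' := 0) (fun r => by simp [(haB r).lie_eq])
    (fun m => by simp [(hx m).lie_eq]), add_zero, zero_smul]

end FormalField
end Dressing

/-! ### Degrees -/

section Degree

variable {K R : Type*} [CommRing K] [Ring R] [Algebra K R] {d f g : R}

theorem lie_mul_eq_smul {m n : K} (hf : ⁅d, f⁆ = m • f) (hg : ⁅d, g⁆ = n • g) :
    ⁅d, f * g⁆ = (m + n) • (f * g) := by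
  rw [lie_mul_eq, hf, hg, smul_mul_assoc, mul_smul_comm, add_smul]

theorem lie_pow_eq_smul {n : K} (hf : ⁅d, f⁆ = n • f) (N : ℕ) : ⁅d, f ^ N⁆ = (N * n) • f ^ N := by
  induction N with
  | zero => simp [Ring.lie_def]
  | succ N ih => rw [pow_succ, lie_mul_eq_smul ih hf, Nat.cast_succ, add_one_mul]

theorem apply_mem_eigenspace_of_lie_eq_smul {V : Type*} [AddCommGroup V] [Module K V]
    {d f : Module.End K V} {n a : K} (h : ⁅d, f⁆ = n • f) {v : V}
    (hv : v ∈ Module.End.eigenspace d a) : f v ∈ Module.End.eigenspace d (a + n) := by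
  rw [Module.End.mem_eigenspace_iff] at hv ⊢
  have lie_apply := LinearMap.congr_fun h v
  rw [Ring.lie_def, LinearMap.sub_apply, Module.End.mul_apply, Module.End.mul_apply, hv, map_smul,
    LinearMap.smul_apply] at lie_apply
  rw [add_smul, ← lie_apply, add_sub_cancel]

variable (K) in
/-- A power series whose coefficient of `t ^ n` has degree `n` for the derivation `⁅d, ·⁆`. -/
def IsHomogeneous (d : R) (F : PowerSeries R) : Prop :=
  ∀ n : ℕ, ⁅d, coeff n F⁆ = (n : K) • coeff n F

theorem IsHomogeneous.mul {F G : PowerSeries R} (hF : IsHomogeneous K d F)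
    (hG : IsHomogeneous K d G) : IsHomogeneous K d (F * G) := by
  intro n
  rw [PowerSeries.coeff_mul, lie_sum, Finset.smul_sum]
  refine Finset.sum_congr rfl fun p hp => ?_
  rw [lie_mul_eq_smul (hF p.1) (hG p.2), ← Finset.HasAntidiagonal.mem_antidiagonal.1 hp,
    Nat.cast_add]

theorem IsHomogeneous.pow {F : PowerSeries R} (hF : IsHomogeneous K d F) (j : ℕ) :
    IsHomogeneous K d (F ^ j) := by
  induction j with
  | zero =>
    intro n
    rw [pow_zero, PowerSeries.coeff_one]
    split_ifs with hn <;> simp [hn, Ring.lie_def]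
  | succ j ih => simpa only [pow_succ] using ih.mul hF

theorem isHomogeneous_psExp {R : Type*} [Ring R] [Algebra ℂ R] {d : R} {F : PowerSeries R}
    (hF : IsHomogeneous ℂ d F) : IsHomogeneous ℂ d (psExp F) := by
  intro n
  rw [psExp, PowerSeries.coeff_mk, lie_sum, Finset.smul_sum]
  refine Finset.sum_congr rfl fun j _ => ?_
  rw [lie_smul, hF.pow j n, smul_comm]

theorem isHomogeneous_modeSeries {R : Type*} [Ring R] [Algebra ℂ R] {d : R} (c : ℕ+ → ℂ)
    {b : ℕ+ → R} (h : ∀ n : ℕ+, ⁅d, b n⁆ = ((n : ℕ) : ℂ) • b n) :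
    IsHomogeneous ℂ d (modeSeries c b) := by
  intro n
  rcases Nat.eq_zero_or_pos n with rfl | hn
  · simp
  · lift n to ℕ+ using hn
    rw [coeff_modeSeries, lie_smul, h, smul_comm]

end Degree

/-! ### The action of the generators on a module of level `k` -/

section Action

variable (X : SimpleType) (ħ : ℂ) (k : ℚ)
variable (V : Type*) [AddCommGroup V] [Module ℂ V] [Module (Uq X ħ) V] [IsScalarTower ℂ (Uq X ħ) V]

/-- The representation of the free algebra on a `U_q(𝔤^)`-module. -/
def freeAct : Free X →ₐ[ℂ] Module.End ℂ V := (Algebra.lsmul ℂ ℂ V).comp (Uq.mk X ħ)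

/-- The module has level `k`: `γ^{1/2}` acts as `q^{k/2}`. -/
def HasLevel : Prop := ∀ v : V, act ħ V (Gen.gamma (X := X)) v = qpow ħ (k / 2) • v

/-- The module is the sum of its homogeneous subspaces, and its degrees are bounded above in every
coset of `ℤ`. -/
structure IsUpperBoundedGraded : Prop where
  graded : ⨆ a, degreeSpace X ħ V a = ⊤
  bounded : ∀ a : ℂ, ∃ n₀ : ℕ, ∀ n : ℕ, n₀ < n → degreeSpace X ħ V (a + n) = ⊥

/-- The matrix with entries `[a_i(n), a_j(-n)] = [(α_i|α_j) n] [n k] / n` at level `k`. -/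
def heisenbergMatrix (n : ℕ+) : Matrix X.Idx X.Idx ℂ :=
  Matrix.of fun i j => qnum ħ (X.form i j * (n : ℕ)) * qnum ħ ((n : ℕ) * k) / ((n : ℕ) : ℂ)

/-- The scalar in `[a_j(±n), x_i^ε(z)] = [(α_j|α_i) n] / n * ε q^{-ε k n / 2} z^{±n} x_i^ε(z)` at
level `k`. -/
def exchangeCoeff (ε : ℤˣ) (j i : X.Idx) (n : ℕ+) : ℂ :=
  ((ε : ℤ) : ℂ) * (qnum ħ (X.form j i * (n : ℕ)) / ((n : ℕ) : ℂ)) *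
    qpow ħ (-(((ε : ℤ) : ℚ) * k * (n : ℕ) / 2))

variable {X ħ k V}

theorem freeAct_gen (g : Gen X) : freeAct X ħ V (gen g) = act ħ V g := rfl

theorem freeAct_eq_of_rel {a b : Free X} (h : Rel X ħ a b) :
    freeAct X ħ V a = freeAct X ħ V b := by
  have mk_eq : Uq.mk X ħ a = Uq.mk X ħ b := RingQuot.mkAlgHom_rel ℂ h
  rw [freeAct, AlgHom.comp_apply, AlgHom.comp_apply, mk_eq]

theorem lie_act_deg_a (i : X.Idx) (n : NZ) :
    ⁅act ħ V (Gen.deg (X := X)), act ħ V (Gen.a i n)⁆ = (n.1 : ℂ) • act ħ V (Gen.a i n) := by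
  simpa only [map_sub, map_mul, map_smul, freeAct_gen, Ring.lie_def] using
    freeAct_eq_of_rel (V := V) (Rel.deg_a (ħ := ħ) i n)

theorem lie_act_deg_x (ε : ℤˣ) (i : X.Idx) (n : ℤ) :
    ⁅act ħ V (Gen.deg (X := X)), act ħ V (Gen.x ε i n)⁆ = (n : ℂ) • act ħ V (Gen.x ε i n) := by
  simpa only [map_sub, map_mul, map_smul, freeAct_gen, Ring.lie_def] using
    freeAct_eq_of_rel (V := V) (Rel.deg_x (ħ := ħ) ε i n)

theorem lie_deg_actAnnih (i : X.Idx) (n : ℕ+) :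
    ⁅act ħ V (Gen.deg (X := X)), actAnnih ħ V i n⁆ = ((n : ℕ) : ℂ) • actAnnih ħ V i n := by
  simpa only [NZ.pos, actAnnih, Int.cast_natCast] using lie_act_deg_a (V := V) i (NZ.pos n)

section Level

variable (hlevel : HasLevel X ħ k V)
include hlevel

theorem act_gamma : act ħ V (Gen.gamma (X := X)) = qpow ħ (k / 2) • 1 := LinearMap.ext hlevel

theorem act_gammaInv : act ħ V (Gen.gammaInv (X := X)) = qpow ħ (-(k / 2)) • 1 := by
  have h := freeAct_eq_of_rel (V := V) (Rel.gamma_inv (ħ := ħ) (X := X))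
  rw [map_mul, map_one, freeAct_gen, freeAct_gen, act_gamma hlevel, smul_mul_assoc, one_mul] at h
  rw [qpow_neg, ← h, smul_smul, inv_mul_cancel₀ (qpow_ne_zero _ _), one_smul]

theorem freeAct_gammaHalfPow (r : ℤ) :
    freeAct X ħ V (gammaHalfPow X r) = qpow ħ (r * (k / 2)) • 1 := by
  rw [gammaHalfPow]
  split_ifs with hr
  · lift r to ℕ using hr
    rw [map_pow, freeAct_gen, act_gamma hlevel, smul_pow, one_pow, ← qpow_nat_mul,
      Int.toNat_natCast, Int.cast_natCast]
  · obtain ⟨n, rfl⟩ : ∃ n : ℕ, r = -n := ⟨(-r).toNat, by omega⟩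
    rw [map_pow, freeAct_gen, act_gammaInv hlevel, smul_pow, one_pow, ← qpow_nat_mul, neg_neg,
      Int.toNat_natCast, mul_neg, Int.cast_neg, Int.cast_natCast, neg_mul]

theorem lie_act_a_a (i j : X.Idx) (m n : NZ) :
    ⁅act ħ V (Gen.a i m), act ħ V (Gen.a j n)⁆ =
      if m.1 = -n.1 then
        (qnum ħ (X.form i j * m.1) * qnum ħ (m.1 * k) / (m.1 : ℂ)) • (1 : Module.End ℂ V)
      else 0 := by
  have h := freeAct_eq_of_rel (V := V) (Rel.a_a (ħ := ħ) i j m n)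
  rw [map_sub, map_mul, map_mul, freeAct_gen, freeAct_gen, ← Ring.lie_def] at h
  rw [h, apply_ite (freeAct X ħ V), map_zero, map_smul, map_sub, freeAct_gammaHalfPow hlevel,
    freeAct_gammaHalfPow hlevel, ← sub_smul, smul_smul, qnum.eq_1 ħ (m.1 * k)]
  have cast_two_mul : ((2 * m.1 : ℤ) : ℚ) * (k / 2) = m.1 * k := by
    push_cast
    ring
  rw [Int.cast_neg, neg_mul, cast_two_mul]
  congr 2
  ring

theorem lie_act_a_x (ε : ℤˣ) (i j : X.Idx) (m : NZ) (n : ℤ) :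
    ⁅act ħ V (Gen.a i m), act ħ V (Gen.x ε j n)⁆ =
      (((ε : ℤ) : ℂ) * (qnum ħ (X.form i j * m.1) / (m.1 : ℂ)) *
        qpow ħ (-(((ε : ℤ) : ℚ) * k * |(m.1 : ℚ)| / 2))) • act ħ V (Gen.x ε j (m.1 + n)) := by
  have h := freeAct_eq_of_rel (V := V) (Rel.a_x (ħ := ħ) ε i j m n)
  rw [map_sub, map_mul, map_mul, freeAct_gen, freeAct_gen, ← Ring.lie_def] at h
  rw [h, map_smul, map_mul, freeAct_gammaHalfPow hlevel, freeAct_gen, smul_mul_assoc, one_mul,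
    smul_smul]
  congr 3
  push_cast
  ring

theorem commute_actAnnih_actAnnih (i j : X.Idx) (m n : ℕ+) :
    Commute (actAnnih ħ V i m) (actAnnih ħ V j n) := by
  refine commute_of_lie_eq_zero ((lie_act_a_a hlevel i j _ _).trans (if_neg ?_))
  have := m.pos
  simp only [NZ.pos]
  omega

theorem commute_actCreate_actCreate (i j : X.Idx) (m n : ℕ+) :
    Commute (actCreate ħ V i m) (actCreate ħ V j n) := by
  refine commute_of_lie_eq_zero ((lie_act_a_a hlevel i j _ _).trans (if_neg ?_))
  have := m.pos
  simp only [NZ.neg]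
  omega

theorem lie_actAnnih_actCreate (i j : X.Idx) (n m : ℕ+) :
    ⁅actAnnih ħ V i n, actCreate ħ V j m⁆ =
      if m = n then heisenbergMatrix X ħ k n i j • (1 : Module.End ℂ V) else 0 := by
  rw [actAnnih, actCreate, lie_act_a_a hlevel]
  simp only [NZ.pos, NZ.neg, neg_neg, Nat.cast_inj, PNat.coe_inj, eq_comm (a := m),
    heisenbergMatrix, Matrix.of_apply, Int.cast_natCast]

theorem lie_actCreate_actAnnih (i j : X.Idx) (n m : ℕ+) :
    ⁅actCreate ħ V i n, actAnnih ħ V j m⁆ =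
      if m = n then -heisenbergMatrix X ħ k n i j • (1 : Module.End ℂ V) else 0 := by
  rw [actAnnih, actCreate, lie_act_a_a hlevel]
  simp only [NZ.pos, NZ.neg, neg_inj, Nat.cast_inj, PNat.coe_inj, eq_comm (a := m),
    heisenbergMatrix, Matrix.of_apply, Int.cast_natCast, Int.cast_neg, mul_neg, neg_mul, qnum_neg,
    neg_neg, div_neg]

theorem lie_actAnnih_xCoeff (ε : ℤˣ) (j i : X.Idx) (n : ℕ+) (m : ℤ) :
    ⁅actAnnih ħ V j n, xCoeff ħ V ε i m⁆ =
      exchangeCoeff X ħ k ε j i n • xCoeff ħ V ε i (m - (n : ℕ)) := by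
  rw [actAnnih, xCoeff, lie_act_a_x hlevel, xCoeff]
  have index_eq : (NZ.pos n).1 + (-m - 1) = -(m - (n : ℕ)) - 1 := by
    simp only [NZ.pos]
    ring
  rw [index_eq, exchangeCoeff]
  simp only [NZ.pos, Int.cast_natCast, Nat.abs_cast]

theorem lie_actCreate_xCoeff (ε : ℤˣ) (j i : X.Idx) (n : ℕ+) (m : ℤ) :
    ⁅actCreate ħ V j n, xCoeff ħ V ε i m⁆ =
      exchangeCoeff X ħ k ε j i n • xCoeff ħ V ε i (m + (n : ℕ)) := by
  rw [actCreate, xCoeff, lie_act_a_x hlevel, xCoeff]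
  have index_eq : (NZ.neg n).1 + (-m - 1) = -(m + (n : ℕ)) - 1 := by
    simp only [NZ.neg]
    ring
  rw [index_eq, exchangeCoeff]
  simp only [NZ.neg, Int.cast_neg, Int.cast_natCast, abs_neg, Nat.abs_cast, mul_neg,
    qnum_neg, neg_div_neg_eq]

end Level

theorem IsUpperBoundedGraded.exists_forall_apply_eq_zero (hgr : IsUpperBoundedGraded X ħ V)
    (v : V) :
    ∃ n₀ : ℕ, ∀ (n : ℕ) (f : Module.End ℂ V), n₀ < n →
      ⁅act ħ V (Gen.deg (X := X)), f⁆ = (n : ℂ) • f → f v = 0 := by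
  have hv : v ∈ ⨆ a, degreeSpace X ħ V a := hgr.graded ▸ Submodule.mem_top
  induction hv using Submodule.iSup_induction' with
  | mem a v hv =>
    obtain ⟨n₀, h⟩ := hgr.bounded a
    refine ⟨n₀, fun n f hn hf => ?_⟩
    have hfv : f v ∈ degreeSpace X ħ V (a + n) := apply_mem_eigenspace_of_lie_eq_smul hf hv
    rwa [h n hn, Submodule.mem_bot] at hfv
  | zero => exact ⟨0, fun n f _ _ => map_zero f⟩
  | add v w _ _ hv hw =>
    obtain ⟨n₁, h₁⟩ := hv
    obtain ⟨n₂, h₂⟩ := hw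
    refine ⟨max n₁ n₂, fun n f hn hf => ?_⟩
    rw [map_add, h₁ n f (by omega) hf, h₂ n f (by omega) hf, add_zero]

/-- The field `x_i^ε(z)`. -/
def xField (hgr : IsUpperBoundedGraded X ħ V) (ε : ℤˣ) (i : X.Idx) : FormalField ℂ V where
  mode := xCoeff ħ V ε i
  exists_forall_lt_apply_eq_zero v := by
    obtain ⟨n₀, h⟩ := hgr.exists_forall_apply_eq_zero v
    refine ⟨-n₀ - 1, fun m hm => h (-m - 1).toNat _ (by omega) ?_⟩
    have toNat_cast : (((-m - 1).toNat : ℤ) : ℂ) = ((-m - 1 : ℤ) : ℂ) := by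
      rw [Int.toNat_of_nonneg (by omega)]
    rw [xCoeff, lie_act_deg_x, ← toNat_cast, Int.cast_natCast]

variable (k) in
theorem IsUpperBoundedGraded.vectorwiseFinite_Eplus (hgr : IsUpperBoundedGraded X ħ V) (ε σ : ℤˣ)
    (i : X.Idx) :
    VectorwiseFinite (Eplus ħ k ε σ (actAnnih ħ V i)) := by
  intro v
  obtain ⟨n₀, h⟩ := hgr.exists_forall_apply_eq_zero v
  exact ⟨n₀ + 1, fun r hr => h r _ (by omega)
    (isHomogeneous_psExp (isHomogeneous_modeSeries _ (lie_deg_actAnnih i)) r)⟩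

end Action

/-! ### The Heisenberg algebra and its vacuum space -/

section Heisenberg

variable {X : SimpleType} {ħ : ℂ} {k : ℚ}
variable {V : Type*} [AddCommGroup V] [Module ℂ V] [Module (Uq X ħ) V] [IsScalarTower ℂ (Uq X ħ) V]

theorem qnum_mul_natCast_ne_zero (hq : ∀ n : ℕ, 0 < n → Complex.exp ħ ^ n ≠ 1) (hk : k ≠ 0)
    (n : ℕ+) : qnum ħ (k * (n : ℕ)) ≠ 0 :=
  qnum_ne_zero hq (mul_ne_zero hk (mod_cast n.ne_zero))

theorem isUnit_det_heisenbergMatrix (hq : ∀ n : ℕ, 0 < n → Complex.exp ħ ^ n ≠ 1) (hk : k ≠ 0)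
    (n : ℕ+) : IsUnit (heisenbergMatrix X ħ k n).det := by
  rw [isUnit_iff_ne_zero]
  intro hdet
  obtain ⟨v, hv, hmul⟩ := Matrix.exists_mulVec_eq_zero_iff.2 hdet
  refine hv (eq_zero_of_form hq (mod_cast n.ne_zero : ((n : ℕ) : ℚ) ≠ 0) X fun i => ?_)
  have scalar_ne_zero : qnum ħ (k * (n : ℕ)) / ((n : ℕ) : ℂ) ≠ 0 :=
    div_ne_zero (qnum_mul_natCast_ne_zero hq hk n) (mod_cast n.ne_zero)
  have hrow := congrFun hmul i
  simp only [Matrix.mulVec, dotProduct, heisenbergMatrix, Matrix.of_apply, Pi.zero_apply] at hrow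
  refine mul_left_cancel₀ scalar_ne_zero ?_
  rw [mul_zero, Finset.mul_sum, ← hrow, mul_comm k]
  exact Finset.sum_congr rfl fun j _ => by ring

variable (ħ k V) in
/-- The combinations of the `a_j(n)` that act as the partial derivatives dual to the `a_i(-n)`. -/
def dualAnnih (p : X.Idx × ℕ+) : Module.End ℂ V :=
  ∑ j, (heisenbergMatrix X ħ k p.2)⁻¹ p.1 j • actAnnih ħ V j p.2

theorem actAnnih_eq_sum_dualAnnih (hq : ∀ n : ℕ, 0 < n → Complex.exp ħ ^ n ≠ 1) (hk : k ≠ 0)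
    (i : X.Idx) (n : ℕ+) :
    actAnnih ħ V i n = ∑ j, heisenbergMatrix X ħ k n i j • dualAnnih ħ k V (j, n) := by
  simp only [dualAnnih, Finset.smul_sum, smul_smul]
  rw [Finset.sum_comm]
  simp only [← Finset.sum_smul, ← Matrix.mul_apply,
    Matrix.mul_nonsing_inv _ (isUnit_det_heisenbergMatrix hq hk n), Matrix.one_apply, ite_smul,
    one_smul, zero_smul, Finset.sum_ite_eq, Finset.mem_univ, if_true]

variable (X ħ V) in
/-- The action on `V` of `K(k)`, viewed as the algebra of polynomials in the `a_i(-n)`. -/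
def fockAct : Fock X →ₐ[ℂ] Module.End ℂ V := (Algebra.lsmul ℂ ℂ V).comp (incl ħ)

theorem fockAct_X (p : X.Idx × ℕ+) :
    fockAct X ħ V (MvPolynomial.X p) = actCreate ħ V p.1 p.2 := by
  rw [fockAct, AlgHom.comp_apply, incl_X]
  rfl

theorem mem_vacuum_iff_actAnnih (hq : ∀ n : ℕ, 0 < n → Complex.exp ħ ^ n ≠ 1) (hk : k ≠ 0)
    {v : V} : v ∈ vacuum X ħ k V ↔ ∀ (i : X.Idx) (n : ℕ+), actAnnih ħ V i n v = 0 := by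
  have Eplus_apply_iff (ε σ : ℤˣ) (i : X.Idx) :
      (∀ n, coeff n (Eplus ħ k ε σ (actAnnih ħ V i)) v = if n = 0 then v else 0) ↔
        ∀ n, actAnnih ħ V i n v = 0 :=
    coeff_psExp_modeSeries_apply_iff fun n => mul_ne_zero (mul_ne_zero (by simp)
      (div_ne_zero (qpow_ne_zero _ _) (qnum_mul_natCast_ne_zero hq hk n))) (by simp)
  exact ⟨fun h i => (Eplus_apply_iff 1 1 i).1 (h 1 1 i),
    fun h ε σ i => (Eplus_apply_iff ε σ i).2 (h i)⟩

theorem mem_vacuum_iff_dualAnnih (hq : ∀ n : ℕ, 0 < n → Complex.exp ħ ^ n ≠ 1) (hk : k ≠ 0)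
    {v : V} : v ∈ vacuum X ħ k V ↔ ∀ p : X.Idx × ℕ+, dualAnnih ħ k V p v = 0 := by
  rw [mem_vacuum_iff_actAnnih hq hk]
  refine ⟨fun h p => ?_, fun h i n => ?_⟩
  · simp [dualAnnih, h]
  · simp [actAnnih_eq_sum_dualAnnih hq hk, h]

theorem lie_dualAnnih_fockAct_X (hq : ∀ n : ℕ, 0 < n → Complex.exp ħ ^ n ≠ 1) (hk : k ≠ 0)
    (hlevel : HasLevel X ħ k V) (p r : X.Idx × ℕ+) :
    ⁅dualAnnih ħ k V p, fockAct X ħ V (MvPolynomial.X r)⁆ = if p = r then 1 else 0 := by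
  obtain ⟨i, n⟩ := p
  obtain ⟨j, m⟩ := r
  simp only [fockAct_X, dualAnnih, sum_lie, smul_lie, lie_actAnnih_actCreate hlevel]
  by_cases hmn : m = n
  · subst hmn
    simp only [if_true, smul_smul, ← Finset.sum_smul, ← Matrix.mul_apply,
      Matrix.nonsing_inv_mul _ (isUnit_det_heisenbergMatrix hq hk m), Matrix.one_apply, ite_smul,
      one_smul, zero_smul, Prod.mk.injEq, and_true]
  · simp [hmn, Ne.symm hmn]

theorem commute_dualAnnih_dualAnnih (hlevel : HasLevel X ħ k V) (p r : X.Idx × ℕ+) :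
    Commute (dualAnnih ħ k V p) (dualAnnih ħ k V r) :=
  Commute.sum_left _ _ _ fun i _ => Commute.sum_right _ _ _ fun j _ =>
    ((commute_actAnnih_actAnnih hlevel i j p.2 r.2).smul_right _).smul_left _

theorem lie_deg_dualAnnih (p : X.Idx × ℕ+) :
    ⁅act ħ V (Gen.deg (X := X)), dualAnnih ħ k V p⁆ = ((p.2 : ℕ) : ℂ) • dualAnnih ħ k V p := by
  rw [dualAnnih, lie_sum, Finset.smul_sum]
  refine Finset.sum_congr rfl fun j _ => ?_
  rw [lie_smul, lie_deg_actAnnih, smul_comm]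

variable (k) in
theorem IsUpperBoundedGraded.exists_dualAnnih_pow_apply_eq_zero
    (hgr : IsUpperBoundedGraded X ħ V) (p : X.Idx × ℕ+) (v : V) :
    ∃ N : ℕ, (dualAnnih ħ k V p ^ N) v = 0 := by
  obtain ⟨n₀, h⟩ := hgr.exists_forall_apply_eq_zero v
  refine ⟨n₀ + 1, h ((n₀ + 1) * p.2) _ (Nat.le_mul_of_pos_right _ p.2.pos) ?_⟩
  rw [lie_pow_eq_smul (lie_deg_dualAnnih p), ← Nat.cast_mul]

variable (k) in
theorem IsUpperBoundedGraded.finite_setOf_dualAnnih_apply_ne_zero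
    (hgr : IsUpperBoundedGraded X ħ V) (v : V) :
    {p : X.Idx × ℕ+ | dualAnnih ħ k V p v ≠ 0}.Finite := by
  obtain ⟨n₀, h⟩ := hgr.exists_forall_apply_eq_zero v
  refine (Set.finite_univ.prod (Set.finite_Iic n₀.succPNat)).subset fun p hp => ?_
  refine ⟨Set.mem_univ _, ?_⟩
  contrapose! hp
  have hlt : n₀ + 1 < p.2 := by simpa [← PNat.coe_lt_coe] using hp
  simpa using h p.2 _ (by omega) (lie_deg_dualAnnih p)

theorem fockMap_fockAct_bijective (hq : ∀ n : ℕ, 0 < n → Complex.exp ħ ^ n ≠ 1) (hk : k ≠ 0)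
    (hlevel : HasLevel X ħ k V) (hgr : IsUpperBoundedGraded X ħ V) :
    Function.Bijective (fockMap (fockAct X ħ V) (vacuum X ħ k V)) :=
  ⟨fockMap_injective (lie_dualAnnih_fockAct_X hq hk hlevel)
      fun _ => (mem_vacuum_iff_dualAnnih hq hk).1,
    fockMap_surjective (lie_dualAnnih_fockAct_X hq hk hlevel)
      (fun _ => (mem_vacuum_iff_dualAnnih hq hk).2) (commute_dualAnnih_dualAnnih hlevel)
      (hgr.exists_dualAnnih_pow_apply_eq_zero k) (hgr.finite_setOf_dualAnnih_apply_ne_zero k)⟩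

theorem fockAct_fockCreate (i : X.Idx) (n : ℕ+) (u : Fock X) (w : V) :
    fockAct X ħ V (fockCreate i n u) w = actCreate ħ V i n (fockAct X ħ V u w) := by
  rw [fockCreate, LinearMap.mulLeft_apply, map_mul, fockAct_X, Module.End.mul_apply]

theorem fockAct_fockAnnih (hlevel : HasLevel X ħ k V) {i : X.Idx} {n : ℕ+} {w : V}
    (hw : actAnnih ħ V i n w = 0) (u : Fock X) :
    fockAct X ħ V (fockAnnih ħ k i n u) w = actAnnih ħ V i n (fockAct X ħ V u w) := by
  let s (p : X.Idx × ℕ+) : ℂ := if p.2 = n then heisenbergMatrix X ħ k n i p.1 else 0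
  have fockAnnih_eq : fockAnnih ħ k i n =
      (MvPolynomial.mkDerivation ℂ fun p => (MvPolynomial.C (s p) : Fock X)).toLinearMap := by
    simp only [fockAnnih, s, apply_ite MvPolynomial.C, map_zero, heisenbergMatrix, Matrix.of_apply]
  rw [apply_algHom_of_apply_eq_zero (s := s) (fun p => ?_) hw, fockAnnih_eq, Derivation.coeFn_coe]
  rw [fockAct_X, lie_actAnnih_actCreate hlevel, ite_smul, zero_smul]

theorem fockAct_fockEE (hlevel : HasLevel X ħ k V) {i : X.Idx} {w : V}
    (hw : ∀ n, actAnnih ħ V i n w = 0) (ε : ℤˣ) (p r : ℕ) (u : Fock X) :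
    fockAct X ħ V (fockEE ħ k ε i p r u) w =
      coeff p (Eminus ħ k ε (-1) (actCreate ħ V i))
        (coeff r (Eplus ħ k ε (-1) (actAnnih ħ V i)) (fockAct X ħ V u w)) := by
  let T : Fock X →ₗ[ℂ] V := LinearMap.applyₗ w ∘ₗ (fockAct X ħ V).toLinearMap
  have map_Eplus : T (coeff r (Eplus ħ k ε (-1) (fockAnnih ħ k i)) u) =
      coeff r (Eplus ħ k ε (-1) (actAnnih ħ V i)) (T u) :=
    coeff_psExp_modeSeries_intertwine _ (fun n => fockAct_fockAnnih hlevel (hw n)) r u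
  have map_Eminus (u : Fock X) : T (coeff p (Eminus ħ k ε (-1) (fockCreate i)) u) =
      coeff p (Eminus ħ k ε (-1) (actCreate ħ V i)) (T u) :=
    coeff_psExp_modeSeries_intertwine _ (fun n u => fockAct_fockCreate i n u w) p u
  exact (map_Eminus _).trans (congrArg _ map_Eplus)

end Heisenberg

/-! ### Z-operators -/

section ZOperators

theorem Eminus_neg_one_mul_Eminus_one {W : Type*} [AddCommGroup W] [Module ℂ W] (ħ : ℂ) (k : ℚ)
    (ε : ℤˣ) (b : ℕ+ → Module.End ℂ W) : Eminus ħ k ε (-1) b * Eminus ħ k ε 1 b = 1 := by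
  have h := psExp_mul_psExp_neg (coeff_zero_modeSeries (fun n => ((ε : ℤ) : ℂ) *
    (qpow ħ (-(((ε : ℤ) : ℚ) * k * (n : ℕ) / 2)) / qnum ħ (k * (n : ℕ)))) b)
  rw [← modeSeries_neg] at h
  simpa only [Eminus, Units.val_neg, Units.val_one, Int.cast_neg, Int.cast_one, mul_neg, mul_one,
    neg_mul, neg_neg] using h

theorem Eplus_one_mul_Eplus_neg_one {W : Type*} [AddCommGroup W] [Module ℂ W] (ħ : ℂ) (k : ℚ)
    (ε : ℤˣ) (b : ℕ+ → Module.End ℂ W) : Eplus ħ k ε 1 b * Eplus ħ k ε (-1) b = 1 := by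
  have h := psExp_mul_psExp_neg (coeff_zero_modeSeries (fun n => ((ε : ℤ) : ℂ) *
    (qpow ħ (-(((ε : ℤ) : ℚ) * k * (n : ℕ) / 2)) / qnum ħ (k * (n : ℕ)))) b)
  rw [← modeSeries_neg] at h
  simpa only [Eplus, Units.val_neg, Units.val_one, Int.cast_neg, Int.cast_one, mul_neg, mul_one]
    using h

variable {X : SimpleType} {ħ : ℂ} {k : ℚ}
variable {V : Type*} [AddCommGroup V] [Module ℂ V] [Module (Uq X ħ) V] [IsScalarTower ℂ (Uq X ħ) V]

variable (k) in
/-- The field `Z^ε(α_i, z)`. -/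
def zField (hgr : IsUpperBoundedGraded X ħ V) (ε : ℤˣ) (i : X.Idx) : FormalField ℂ V :=
  ((xField hgr ε i).rmul (hgr.vectorwiseFinite_Eplus k ε 1 i)).lmul
    (Eminus ħ k ε 1 (actCreate ħ V i))

variable (k) in
theorem finite_support_zTerm (hgr : IsUpperBoundedGraded X ħ V) (ε : ℤˣ) (i : X.Idx) (m : ℤ)
    (v : V) : (Function.support (zTerm ħ k V ε i m v)).Finite :=
  (xField hgr ε i).finite_support_lmul_rmul _ (hgr.vectorwiseFinite_Eplus k ε 1 i) m v

variable (k) in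
theorem zField_mode_apply (hgr : IsUpperBoundedGraded X ħ V) (ε : ℤˣ) (i : X.Idx) (m : ℤ)
    (v : V) : (zField k hgr ε i).mode m v = zCoeff ħ k V ε i m v :=
  (xField hgr ε i).lmul_rmul_apply _ (hgr.vectorwiseFinite_Eplus k ε 1 i) m v

variable (k) in
theorem rmul_lmul_zField (hgr : IsUpperBoundedGraded X ħ V) (ε : ℤˣ) (i : X.Idx) :
    ((zField k hgr ε i).rmul (hgr.vectorwiseFinite_Eplus k ε (-1) i)).lmul
      (Eminus ħ k ε (-1) (actCreate ħ V i)) = xField hgr ε i :=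
  (xField hgr ε i).lmul_rmul_lmul_rmul (Eminus_neg_one_mul_Eminus_one ħ k ε _) _ _
    (Eplus_one_mul_Eplus_neg_one ħ k ε _)

section Commutation

variable (hq : ∀ n : ℕ, 0 < n → Complex.exp ħ ^ n ≠ 1) (hk : k ≠ 0) (hlevel : HasLevel X ħ k V)
  (hgr : IsUpperBoundedGraded X ħ V) (ε : ℤˣ) (i : X.Idx)
include hq hk hlevel

theorem lie_actAnnih_coeff_Eminus (j : X.Idx) (n : ℕ+) (p : ℕ) :
    ⁅actAnnih ħ V j n, coeff p (Eminus ħ k ε 1 (actCreate ħ V i))⁆ =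
      if (n : ℕ) ≤ p then
        -exchangeCoeff X ħ k ε j i n • coeff (p - n) (Eminus ħ k ε 1 (actCreate ħ V i))
      else 0 := by
  have coeff_eq : -((ε : ℤ) : ℂ) *
      (qpow ħ (-(((ε : ℤ) : ℚ) * k * (n : ℕ) / 2)) / qnum ħ (k * (n : ℕ))) *
        (((1 : ℤˣ) : ℤ) : ℂ) * heisenbergMatrix X ħ k n j i = -exchangeCoeff X ħ k ε j i n := by
    have hkn := qnum_mul_natCast_ne_zero hq hk n
    rw [heisenbergMatrix, Matrix.of_apply, mul_comm _ k, Units.val_one, Int.cast_one, mul_one,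
      exchangeCoeff]
    field_simp
  rw [Eminus, lie_coeff_psExp_modeSeries _ (lie_actAnnih_actCreate hlevel j i n), coeff_eq]

theorem lie_actCreate_coeff_Eplus (j : X.Idx) (n : ℕ+) (r : ℕ) :
    ⁅actCreate ħ V j n, coeff r (Eplus ħ k ε 1 (actAnnih ħ V i))⁆ =
      if (n : ℕ) ≤ r then
        -exchangeCoeff X ħ k ε j i n • coeff (r - n) (Eplus ħ k ε 1 (actAnnih ħ V i))
      else 0 := by
  have coeff_eq : ((ε : ℤ) : ℂ) *
      (qpow ħ (-(((ε : ℤ) : ℚ) * k * (n : ℕ) / 2)) / qnum ħ (k * (n : ℕ))) *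
        (((1 : ℤˣ) : ℤ) : ℂ) * -heisenbergMatrix X ħ k n j i = -exchangeCoeff X ħ k ε j i n := by
    have hkn := qnum_mul_natCast_ne_zero hq hk n
    rw [heisenbergMatrix, Matrix.of_apply, mul_comm _ k, Units.val_one, Int.cast_one, mul_one,
      exchangeCoeff]
    field_simp
  rw [Eplus, lie_coeff_psExp_modeSeries _ (lie_actCreate_actAnnih hlevel j i n), coeff_eq]

theorem commute_actAnnih_zField (j : X.Idx) (n : ℕ+) (m : ℤ) :
    Commute (actAnnih ħ V j n) ((zField k hgr ε i).mode m) := by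
  rw [zField, ← FormalField.rmul_lmul]
  refine FormalField.commute_rmul _
    (commute_coeff_psExp_modeSeries _ (commute_actAnnih_actAnnih hlevel j i n))
    (fun m => commute_of_lie_eq_zero ?_) m
  rw [FormalField.lie_lmul (lie_actAnnih_coeff_Eminus hq hk hlevel ε i j n)
    (lie_actAnnih_xCoeff hlevel ε j i n), neg_add_cancel, zero_smul]

theorem commute_actCreate_zField (j : X.Idx) (n : ℕ+) (m : ℤ) :
    Commute (actCreate ħ V j n) ((zField k hgr ε i).mode m) := by
  refine FormalField.commute_lmul
    (commute_coeff_psExp_modeSeries _ (commute_actCreate_actCreate hlevel j i n))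
    (fun m => commute_of_lie_eq_zero ?_) m
  rw [FormalField.lie_rmul _ (lie_actCreate_coeff_Eplus hq hk hlevel ε i j n)
    (lie_actCreate_xCoeff hlevel ε j i n), neg_add_cancel, zero_smul]

theorem zField_mode_mem_vacuum (m : ℤ) {w : V} (hw : w ∈ vacuum X ħ k V) :
    (zField k hgr ε i).mode m w ∈ vacuum X ħ k V := by
  rw [mem_vacuum_iff_actAnnih hq hk] at hw ⊢
  intro j n
  rw [← Module.End.mul_apply, (commute_actAnnih_zField hq hk hlevel hgr ε i j n m).eq,
    Module.End.mul_apply, hw, map_zero]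

theorem commute_fockAct_zField (m : ℤ) (u : Fock X) :
    Commute (fockAct X ħ V u) ((zField k hgr ε i).mode m) := by
  induction u using MvPolynomial.induction_on with
  | C c =>
    rw [← MvPolynomial.algebraMap_eq, AlgHom.commutes]
    exact Algebra.commutes c _
  | add u v hu hv =>
    rw [map_add]
    exact hu.add_left hv
  | mul_X u p hu =>
    rw [map_mul, fockAct_X]
    exact hu.mul_left (commute_actCreate_zField hq hk hlevel hgr ε i p.1 p.2 m)

/-- The coefficient of `z ^ m` in `Z^ε(α_i, z)` as an operator on the vacuum space. -/
def vacuumZ (m : ℤ) : Module.End ℂ (vacuum X ħ k V) :=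
  ((zField k hgr ε i).mode m).restrict fun _ => zField_mode_mem_vacuum hq hk hlevel hgr ε i m

theorem coe_vacuumZ_apply (m : ℤ) (w : vacuum X ħ k V) :
    (vacuumZ hq hk hlevel hgr ε i m w : V) = zCoeff ħ k V ε i m w :=
  zField_mode_apply k hgr ε i m w

theorem fockMap_map_fockEE_vacuumZ (p r : ℕ) (m : ℤ) (t : Fock X ⊗[ℂ] vacuum X ħ k V) :
    fockMap (fockAct X ħ V) _
        (TensorProduct.map (fockEE ħ k ε i p r) (vacuumZ hq hk hlevel hgr ε i m) t) =
      coeff p (Eminus ħ k ε (-1) (actCreate ħ V i)) ((zField k hgr ε i).mode m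
        (coeff r (Eplus ħ k ε (-1) (actAnnih ħ V i)) (fockMap (fockAct X ħ V) _ t))) := by
  induction t with
  | zero => simp only [map_zero]
  | add t t' h h' => simp only [map_add, h, h']
  | tmul u w =>
    have annih_zw := (mem_vacuum_iff_actAnnih hq hk).1 (vacuumZ hq hk hlevel hgr ε i m w).2 i
    have commute_Eplus : Commute (coeff r (Eplus ħ k ε (-1) (actAnnih ħ V i)))
        ((zField k hgr ε i).mode m) :=
      (commute_coeff_psExp_modeSeries _
        (fun n => (commute_actAnnih_zField hq hk hlevel hgr ε i i n m).symm) r).symm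
    have commute_u := commute_fockAct_zField hq hk hlevel hgr ε i m u
    rw [TensorProduct.map_tmul, fockMap_tmul, fockMap_tmul, fockAct_fockEE hlevel annih_zw,
      ← Module.End.mul_apply (zField k hgr ε i |>.mode m), ← commute_Eplus.eq,
      Module.End.mul_apply, ← Module.End.mul_apply (zField k hgr ε i |>.mode m), ← commute_u.eq]
    rfl

theorem finite_support_map_fockEE_vacuumZ (m : ℤ) (t : Fock X ⊗[ℂ] vacuum X ħ k V) :
    (Function.support fun pr : ℕ × ℕ => TensorProduct.map (fockEE ħ k ε i pr.1 pr.2)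
      (vacuumZ hq hk hlevel hgr ε i (m - pr.1 + pr.2)) t).Finite := by
  refine ((zField k hgr ε i).finite_support_lmul_rmul (Eminus ħ k ε (-1) (actCreate ħ V i))
    (hgr.vectorwiseFinite_Eplus k ε (-1) i) m (fockMap (fockAct X ħ V) _ t)).subset fun pr hpr => ?_
  rw [Function.mem_support, ← fockMap_map_fockEE_vacuumZ hq hk hlevel]
  exact (map_ne_zero_iff _ (fockMap_fockAct_bijective hq hk hlevel hgr).1).2 hpr

theorem xCoeff_fockMap (m : ℤ) (t : Fock X ⊗[ℂ] vacuum X ħ k V) :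
    xCoeff ħ V ε i m (fockMap (fockAct X ħ V) _ t) =
      fockMap (fockAct X ħ V) _ (∑ᶠ pr : ℕ × ℕ, TensorProduct.map (fockEE ħ k ε i pr.1 pr.2)
        (vacuumZ hq hk hlevel hgr ε i (m - pr.1 + pr.2)) t) := by
  calc xCoeff ħ V ε i m (fockMap (fockAct X ħ V) _ t)
      = (((zField k hgr ε i).rmul (hgr.vectorwiseFinite_Eplus k ε (-1) i)).lmul
          (Eminus ħ k ε (-1) (actCreate ħ V i))).mode m (fockMap (fockAct X ħ V) _ t) := by
        rw [rmul_lmul_zField]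
        rfl
    _ = ∑ᶠ pr : ℕ × ℕ, fockMap (fockAct X ħ V) _ (TensorProduct.map (fockEE ħ k ε i pr.1 pr.2)
          (vacuumZ hq hk hlevel hgr ε i (m - pr.1 + pr.2)) t) := by
        simp only [FormalField.lmul_rmul_apply, fockMap_map_fockEE_vacuumZ]
    _ = _ := ((fockMap (fockAct X ħ V) _).toAddMonoidHom.map_finsum
        (finite_support_map_fockEE_vacuumZ hq hk hlevel hgr ε i m t)).symm

end Commutation

end ZOperators

end QAff

end

theorem theorem2p3_general (X : QAff.SimpleType) (ħ : ℂ)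
    (hq : ∀ n : ℕ, 0 < n → Complex.exp ħ ^ n ≠ 1)
    (k : ℚ) (hk : k ≠ 0)
    (V : Type*) [AddCommGroup V] [Module ℂ V] [Module (QAff.Uq X ħ) V]
    [IsScalarTower ℂ (QAff.Uq X ħ) V] (hlevel : QAff.HasLevel X ħ k V)
    (hgr : QAff.IsUpperBoundedGraded X ħ V) :
    (∀ (ε : ℤˣ) (i : X.Idx) (m : ℤ) (v : V),
      (Function.support (QAff.zTerm ħ k V ε i m v)).Finite) ∧
    ∃ Φ : QAff.Fock X ⊗[ℂ] QAff.vacuum X ħ k V ≃ₗ[ℂ] V,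
      (∀ (u : QAff.Fock X) (w : QAff.vacuum X ħ k V),
        Φ (u ⊗ₜ[ℂ] w) = QAff.incl ħ u • (w : V)) ∧
      ∃ Z : ℤˣ → X.Idx → ℤ → Module.End ℂ (QAff.vacuum X ħ k V),
        (∀ (ε : ℤˣ) (i : X.Idx) (m : ℤ) (w : QAff.vacuum X ħ k V),
          (Z ε i m w : V) = QAff.zCoeff ħ k V ε i m (w : V)) ∧
        ∀ (ε : ℤˣ) (i : X.Idx) (m : ℤ) (t : QAff.Fock X ⊗[ℂ] QAff.vacuum X ħ k V),
          (Function.support fun pr : ℕ × ℕ =>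
            TensorProduct.map (QAff.fockEE ħ k ε i pr.1 pr.2) (Z ε i (m - pr.1 + pr.2)) t).Finite ∧
          QAff.xCoeff ħ V ε i m (Φ t) =
            Φ (∑ᶠ pr : ℕ × ℕ,
              TensorProduct.map (QAff.fockEE ħ k ε i pr.1 pr.2) (Z ε i (m - pr.1 + pr.2)) t) := by
  refine ⟨QAff.finite_support_zTerm k hgr, LinearEquiv.ofBijective _
    (QAff.fockMap_fockAct_bijective hq hk hlevel hgr), fun _ _ => rfl,
    QAff.vacuumZ hq hk hlevel hgr, QAff.coe_vacuumZ_apply hq hk hlevel hgr, fun ε i m t => ?_⟩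
  exact ⟨QAff.finite_support_map_fockEE_vacuumZ hq hk hlevel hgr ε i m t,
    QAff.xCoeff_fockMap hq hk hlevel hgr ε i m t⟩

theorem theorem2p3 (X : QAff.SimpleType) (ħ : ℂ)
    (hq : ∀ n : ℕ, 0 < n → Complex.exp ħ ^ n ≠ 1)
    (k : ℚ) (hk : k ≠ 0)
    (V : Type*) [AddCommGroup V] [Module ℂ V] [Module (QAff.Uq X ħ) V]
    [IsScalarTower ℂ (QAff.Uq X ħ) V] (hV : QAff.InCategory X ħ k V) :
    -- all sums defining the coefficients of the Z-operators are finite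
    (∀ (ε : ℤˣ) (i : X.Idx) (m : ℤ) (v : V),
      (Function.support (QAff.zTerm ħ k V ε i m v)).Finite) ∧
    ∃ Φ : QAff.Fock X ⊗[ℂ] QAff.vacuum X ħ k V ≃ₗ[ℂ] V,
      (∀ (u : QAff.Fock X) (w : QAff.vacuum X ħ k V),
        Φ (u ⊗ₜ[ℂ] w) = QAff.incl ħ u • (w : V)) ∧
      -- the Z-operators restrict to linear operators on the vacuum space
      ∃ Z : ℤˣ → X.Idx → ℤ → Module.End ℂ (QAff.vacuum X ħ k V),
        (∀ (ε : ℤˣ) (i : X.Idx) (m : ℤ) (w : QAff.vacuum X ħ k V),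
          (Z ε i m w : V) = QAff.zCoeff ħ k V ε i m (w : V)) ∧
        -- the coefficient of `z ^ m` in the factorization of `x_i^ε(z)`
        ∀ (ε : ℤˣ) (i : X.Idx) (m : ℤ) (t : QAff.Fock X ⊗[ℂ] QAff.vacuum X ħ k V),
          (Function.support fun pr : ℕ × ℕ =>
            TensorProduct.map (QAff.fockEE ħ k ε i pr.1 pr.2) (Z ε i (m - pr.1 + pr.2)) t).Finite ∧
          QAff.xCoeff ħ V ε i m (Φ t) =
            Φ (∑ᶠ pr : ℕ × ℕ,
              TensorProduct.map (QAff.fockEE ħ k ε i pr.1 pr.2) (Z ε i (m - pr.1 + pr.2)) t) := by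
  exact theorem2p3_general X ħ hq k hk V hV.level ⟨hV.graded, hV.bounded⟩
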